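/- Let $m\ge 2$, let $\sigma_m$ be the surface measure of the unit sphere $S^m\subset\mathbb{R}^{m+1}$, and let $\omega_m=\sigma_m(S^m)=2\pi^{(m+1)/2}/\Gamma((m+1)/2)$. For $p\ge 1$ let $L^p(S^m)=L^p(S^m,\sigma_m)$ be the complex Lebesgue space with norm $\|f\|_p=\big(\int_{S^m}|f|^p\,d\sigma_m\big)^{1/p}$. For $k\ge 0$ let $\mathcal H_k^m$ be the space of spherical harmonics of degree $k$ in $m+1$ variables, $d_k^m=\dim\mathcal H_k^m$, and let $\{Y_{k,j}:1\le j\le d_k^m\}$ be any orthonormal basis of $\mathcal H_k^m$ for the inner product $\int_{S^m} f\overline g\,d\sigma_m$. Put $$\hat f(k,j)=\int_{S^m} f\,\overline{Y_{k,j}}\,d\sigma_m,\qquad \mathcal Y_k f=\sum_{j=1}^{d_k^m}\hat f(k,j)\,Y_{k,j}.$$ A linear operator $M:L^p(S^m)\to L^p(S^m)$ is called a multiplier operator with sequence of multipliers $\{\eta_k\}_{k\ge0}\subset\mathbb C$ if $\mathcal Y_k(Mf)=\eta_k\mathcal Y_k f$ for all $f\in L^p(S^m)$ and all $k\ge 0$.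 Theorem. Let $M$ be a multiplier operator on $L^p(S^m)$ with sequence of multipliers $\{\eta_k\}$. (i) If $1<p\le 2$ and $1/p+1/q=1$, then for every $f\in L^p(S^m)$ the following series converges and $$\left\{\sum_{k=0}^{\infty}\left((d_k^m)^{(2-q)/2q}\,|\eta_k-1|\Big[\sum_{j=1}^{d_k^m}|\hat f(k,j)|^2\Big]^{1/2}\right)^{q}\right\}^{1/q}\le \omega_m^{(p-2)/2p}\,\|Mf-f\|_p .$$ For $p=2$ this inequality is an equality. (ii) If $p=1$, then for every $f\in L^1(S^m)$ the following supremum is finite and $$\sup_{k\ge 0}\left\{(d_k^m)^{-1/2}\,|\eta_k-1|\Big[\sum_{j=1}^{d_k^m}|\hat f(k,j)|^2\Big]^{1/2}\right\}\le \omega_m^{-1/2}\,\|Mf-f\|_1 .$$ -/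

import Mathlib

open MeasureTheory
open scoped ENNReal

noncomputable section

/-- The unit sphere `S^m` in `ℝ^(m+1)`. -/
abbrev Sph (m : ℕ) : Type := Metric.sphere (0 : EuclideanSpace ℝ (Fin (m + 1))) 1

/-- The surface measure `σ_m` on `S^m` (total mass `omegaSph m`). -/
def sphMeasure (m : ℕ) : Measure (Sph m) :=
  (volume : Measure (EuclideanSpace ℝ (Fin (m + 1)))).toSphere

/-- The surface area `ω_m = 2 π^((m+1)/2) / Γ((m+1)/2)` of `S^m`. -/
def omegaSph (m : ℕ) : ℝ :=
  2 * Real.pi ^ (((m : ℝ) + 1) / 2) / Real.Gamma (((m : ℝ) + 1) / 2)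

/-- The formal Laplacian on complex polynomials in `m + 1` variables. -/
def polyLaplacian (m : ℕ) :
    MvPolynomial (Fin (m + 1)) ℂ →ₗ[ℂ] MvPolynomial (Fin (m + 1)) ℂ :=
  ∑ i : Fin (m + 1),
    (MvPolynomial.pderiv i).toLinearMap ∘ₗ (MvPolynomial.pderiv i).toLinearMap

/-- Restriction of a complex polynomial in `m + 1` variables to the sphere `S^m`. -/
def restrictSph (m : ℕ) : MvPolynomial (Fin (m + 1)) ℂ →ₗ[ℂ] (Sph m → ℂ) :=
  LinearMap.pi fun x : Sph m =>
    (MvPolynomial.aeval fun i : Fin (m + 1) => ((x.1 i : ℝ) : ℂ)).toLinearMap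

/-- The space `H_k^m` of spherical harmonics of degree `k` in `m + 1` variables: restrictions to
`S^m` of homogeneous harmonic polynomials of degree `k` with complex coefficients. -/
def sphHarmonics (m k : ℕ) : Submodule ℂ (Sph m → ℂ) :=
  (MvPolynomial.homogeneousSubmodule (Fin (m + 1)) ℂ k ⊓ LinearMap.ker (polyLaplacian m)).map
    (restrictSph m)

/-- The dimension `d_k^m` of `H_k^m`. -/
def dimHarmonics (m k : ℕ) : ℕ := Module.finrank ℂ (sphHarmonics m k)

/-- `Y` is an orthonormal basis of `H_k^m` for the inner product
`⟨f, g⟩ = ∫ f * conj g dσ_m` of `L²(S^m, σ_m)`. -/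
structure IsHarmonicONB (m k : ℕ) (Y : Fin (dimHarmonics m k) → Sph m → ℂ) : Prop where
  span_eq : Submodule.span ℂ (Set.range Y) = sphHarmonics m k
  orthonormal : ∀ i j, ∫ x, Y i x * starRingEnd ℂ (Y j x) ∂(sphMeasure m) = if i = j then 1 else 0

/-- The Fourier coefficients of `f` with respect to the system `Y`:
`∫ f * conj (Y k j) dσ_m`. -/
def sphFourier {m : ℕ} (Y : (k : ℕ) → Fin (dimHarmonics m k) → Sph m → ℂ) (f : Sph m → ℂ)
    (k : ℕ) (j : Fin (dimHarmonics m k)) : ℂ :=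
  ∫ y, f y * starRingEnd ℂ (Y k j y) ∂(sphMeasure m)

/-- The projection of `f` onto `H_k^m`, through its Fourier coefficients. -/
def sphProj {m : ℕ} (Y : (k : ℕ) → Fin (dimHarmonics m k) → Sph m → ℂ) (k : ℕ)
    (f : Sph m → ℂ) : Sph m → ℂ :=
  fun x => ∑ j, sphFourier Y f k j * Y k j x

/-- `T` is a multiplier operator on `L^p(S^m)` with sequence of multipliers `η`. No boundedness
of `T` is required. -/
def IsMultiplierOperator {m : ℕ} (Y : (k : ℕ) → Fin (dimHarmonics m k) → Sph m → ℂ) {p : ℝ≥0∞}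
    (T : Lp ℂ p (sphMeasure m) →ₗ[ℂ] Lp ℂ p (sphMeasure m)) (η : ℕ → ℂ) : Prop :=
  ∀ (f : Lp ℂ p (sphMeasure m)) (k : ℕ), sphProj Y k (T f) = η k • sphProj Y k f

end

/-! By orthonormality the coefficients of `M f - f` are `(η k - 1)` times those of `f`. The theorem
is therefore the Hausdorff–Young inequality for spherical harmonics, applied to `g = M f - f`;
neither boundedness of `M` nor growth of `η` enters.

Hausdorff–Young interpolates between two endpoints. At `p = 1`, rotation invariance makes `∑ⱼ
|Yⱼ(x)|²` constant, hence equal to `d_k / ω_m` (`sum_normSq_eq`). Pairing `g` with its own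
projection then bounds the degree-`k` block of coefficients by `√(d_k / ω_m) ‖g‖₁`
(`sqrt_sum_normSq_fourier_le`). At `p = 2` Parseval holds (`hasSum_normSq_fourier`), which also
gives the equality case. It needs orthogonality of different degrees, from a Green-type identity on
the sphere (`sphInt_polyLaplacian`), and completeness, from `P = H + |x|² Q` with `H` harmonic
together with Stone–Weierstrass.

The interpolation (`sum_rpow_le_of_interpolation`) is the three lines theorem on a finite measure
space with finitely many degrees. A simple function factors through its finite range, so this case
suffices: density extends the bound to `L^p`, and bounds uniform over finite sets of degrees give
the series. -/

noncomputable section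

open MvPolynomial

variable {m : ℕ}

/-! ### The Laplacian and the harmonic decomposition of homogeneous polynomials -/

theorem polyLaplacian_apply (P : MvPolynomial (Fin (m + 1)) ℂ) :
    polyLaplacian m P = ∑ i, pderiv i (pderiv i P) := by
  simp [polyLaplacian, LinearMap.sum_apply]

theorem pderiv_comm' (i j : Fin (m + 1)) (P : MvPolynomial (Fin (m + 1)) ℂ) :
    pderiv i (pderiv j P) = pderiv j (pderiv i P) := by
  ext s
  by_cases h : i = j
  · rw [h]
  · simp [coeff_pderiv, h, Ne.symm h, add_right_comm]
    ring

theorem polyLaplacian_pderiv (i : Fin (m + 1)) (P : MvPolynomial (Fin (m + 1)) ℂ) :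
    polyLaplacian m (pderiv i P) = pderiv i (polyLaplacian m P) := by
  simp only [polyLaplacian_apply, map_sum]
  refine Finset.sum_congr rfl fun j _ => ?_
  rw [pderiv_comm' j i P, pderiv_comm' j i]

theorem polyLaplacian_mul (P Q : MvPolynomial (Fin (m + 1)) ℂ) :
    polyLaplacian m (P * Q) =
      P * polyLaplacian m Q + polyLaplacian m P * Q + 2 * ∑ i, pderiv i P * pderiv i Q := by
  simp only [polyLaplacian_apply, pderiv_mul, map_add, Finset.sum_add_distrib,
    Finset.mul_sum, Finset.sum_mul, two_mul]
  ring

/-- The polynomial `x₀² + ⋯ + x_m²`. -/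
def polyNormSq (m : ℕ) : MvPolynomial (Fin (m + 1)) ℂ := ∑ i, X i ^ 2

theorem polyNormSq_isHomogeneous : (polyNormSq m).IsHomogeneous 2 :=
  IsHomogeneous.sum _ _ _ fun i _ => by simpa using (isHomogeneous_X ℂ i).pow 2

theorem isHomogeneous_polyNormSq_mul {d : ℕ} {Q : MvPolynomial (Fin (m + 1)) ℂ}
    (hQ : Q.IsHomogeneous d) : (polyNormSq m * Q).IsHomogeneous (d + 2) :=
  add_comm 2 d ▸ polyNormSq_isHomogeneous.mul hQ

theorem pderiv_polyNormSq (i : Fin (m + 1)) : pderiv i (polyNormSq m) = 2 * X i := by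
  simp [polyNormSq, pderiv_X, Pi.single_apply]

theorem polyLaplacian_polyNormSq : polyLaplacian m (polyNormSq m) = 2 * ((m : MvPolynomial _ ℂ) + 1) := by
  rw [polyLaplacian_apply]
  simp only [pderiv_polyNormSq, pderiv_mul, pderiv_X_self]
  have : ∀ i : Fin (m + 1), pderiv i (2 : MvPolynomial (Fin (m + 1)) ℂ) = 0 := fun i =>
    pderiv_C (R := ℂ) (i := i) (a := 2)
  simp [this]
  ring

/-- The cross term of the product rule is `4 ∑ xᵢ ∂ᵢQ`, which Euler's identity turns into `4d Q`. -/
theorem polyLaplacian_polyNormSq_mul {d : ℕ} {Q : MvPolynomial (Fin (m + 1)) ℂ}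
    (hQ : Q.IsHomogeneous d) :
    polyLaplacian m (polyNormSq m * Q) =
      (2 * (m + 1) + 4 * d : ℂ) • Q + polyNormSq m * polyLaplacian m Q := by
  rw [polyLaplacian_mul, polyLaplacian_polyNormSq]
  have h := hQ.sum_X_mul_pderiv
  simp only [pderiv_polyNormSq, mul_assoc, ← Finset.mul_sum, h]
  rw [smul_eq_C_mul]
  simp only [map_add, map_mul, nsmul_eq_mul, map_natCast, map_one, map_ofNat]
  ring

theorem pderiv_eq_zero_of_isHomogeneous_zero {P : MvPolynomial (Fin (m + 1)) ℂ} (hP : P.IsHomogeneous 0)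
    (i : Fin (m + 1)) : pderiv i P = 0 := by
  rw [← totalDegree_zero_iff_isHomogeneous, totalDegree_eq_zero_iff_eq_C] at hP
  rw [hP, pderiv_C]

theorem isHomogeneous_polyLaplacian {d : ℕ} {P : MvPolynomial (Fin (m + 1)) ℂ}
    (hP : P.IsHomogeneous (d + 2)) : (polyLaplacian m P).IsHomogeneous d := by
  rw [polyLaplacian_apply]
  exact IsHomogeneous.sum _ _ _ fun i _ => by simpa using (hP.pderiv (i := i)).pderiv (i := i)

theorem polyLaplacian_eq_zero_of_isHomogeneous {d : ℕ} {P : MvPolynomial (Fin (m + 1)) ℂ}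
    (hP : P.IsHomogeneous d) (hd : d < 2) : polyLaplacian m P = 0 := by
  rw [polyLaplacian_apply]
  refine Finset.sum_eq_zero fun i _ => pderiv_eq_zero_of_isHomogeneous_zero ?_ i
  have := hP.pderiv (i := i)
  rwa [show d - 1 = 0 by omega] at this

/-- The operator `c + |x|²Δ` is surjective on homogeneous polynomials of a given degree. -/
theorem exists_smul_add_polyNormSq_mul_polyLaplacian (d : ℕ) :
    ∀ c : ℝ, 0 < c → ∀ P : MvPolynomial (Fin (m + 1)) ℂ, P.IsHomogeneous d →
      ∃ Q : MvPolynomial (Fin (m + 1)) ℂ, Q.IsHomogeneous d ∧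
        (c : ℂ) • Q + polyNormSq m * polyLaplacian m Q = P := by
  induction d using Nat.strong_induction_on with
  | _ d ih =>
    intro c hc P hP
    have hc' : (c : ℂ) ≠ 0 := by exact_mod_cast hc.ne'
    obtain hd | ⟨e, rfl⟩ : d < 2 ∨ ∃ e, d = e + 2 := by
      rcases lt_or_ge d 2 with h | h
      · exact .inl h
      · exact .inr ⟨d - 2, by omega⟩
    · have hQ : ((c : ℂ)⁻¹ • P).IsHomogeneous d := (homogeneousSubmodule _ _ d).smul_mem _ hP
      exact ⟨_, hQ, by rw [polyLaplacian_eq_zero_of_isHomogeneous hQ hd, smul_smul, mul_inv_cancel₀ hc']; simp⟩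
    -- Applying `Δ` to the equation shows that `S = ΔQ` must solve the same kind of equation two
    -- degrees lower, with right side `ΔP` and `c` increased by `2(m+1) + 4e`. The constant stays
    -- positive, so it can always be inverted, and `Q` is recovered as `c⁻¹(P - |x|² S)`.
    · obtain ⟨S, hS, hSeq⟩ := ih e (by omega) (c + (2 * (m + 1) + 4 * e)) (by positivity) _
        (isHomogeneous_polyLaplacian hP)
      have hQ : ((c : ℂ)⁻¹ • (P - polyNormSq m * S)).IsHomogeneous (e + 2) :=
        (homogeneousSubmodule _ _ (e + 2)).smul_mem _
          (hP.sub (isHomogeneous_polyNormSq_mul hS))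
      refine ⟨_, hQ, ?_⟩
      have hL : polyLaplacian m ((c : ℂ)⁻¹ • (P - polyNormSq m * S)) = S := by
        rw [map_smul, map_sub, polyLaplacian_polyNormSq_mul hS, ← hSeq]
        push_cast
        rw [add_smul, inv_smul_eq_iff₀ hc']
        abel
      rw [hL, smul_smul, mul_inv_cancel₀ hc']
      simp

/-- A homogeneous polynomial is the sum of a harmonic one and a multiple of `|x|²`. -/
theorem exists_harmonic_add_polyNormSq_mul {d : ℕ} {P : MvPolynomial (Fin (m + 1)) ℂ}
    (hP : P.IsHomogeneous (d + 2)) :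
    ∃ H Q : MvPolynomial (Fin (m + 1)) ℂ, H.IsHomogeneous (d + 2) ∧ polyLaplacian m H = 0 ∧
      Q.IsHomogeneous d ∧ P = H + polyNormSq m * Q := by
  -- With this constant the solved equation reads `Δ(|x|² Q) = ΔP`.
  obtain ⟨Q, hQ, hQeq⟩ := exists_smul_add_polyNormSq_mul_polyLaplacian (m := m) d
    (2 * (m + 1) + 4 * d) (by positivity) _ (isHomogeneous_polyLaplacian hP)
  refine ⟨P - polyNormSq m * Q, Q, hP.sub (isHomogeneous_polyNormSq_mul hQ), ?_, hQ, by ring⟩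
  rw [map_sub, polyLaplacian_polyNormSq_mul hQ, ← hQeq]
  push_cast
  simp

/-! ### Linear changes of variables and derivatives along curves -/

/-- The linear substitution `xᵢ ↦ ∑ⱼ Aᵢⱼ xⱼ`. -/
def polySubst (A : Matrix (Fin (m + 1)) (Fin (m + 1)) ℂ) :
    MvPolynomial (Fin (m + 1)) ℂ →ₐ[ℂ] MvPolynomial (Fin (m + 1)) ℂ :=
  bind₁ fun i => ∑ j, C (A i j) * X j

theorem pderiv_polySubst (A : Matrix (Fin (m + 1)) (Fin (m + 1)) ℂ) (k : Fin (m + 1))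
    (P : MvPolynomial (Fin (m + 1)) ℂ) :
    pderiv k (polySubst A P) = ∑ i, C (A i k) * polySubst A (pderiv i P) := by
  induction P using MvPolynomial.induction_on with
  | C a => simp [polySubst]
  | add p q hp hq => simp [hp, hq, mul_add, Finset.sum_add_distrib]
  | mul_X p l hp =>
    have hX : pderiv k (polySubst A (X l)) = C (A l k) := by
      simp [polySubst, pderiv_X, Pi.single_apply]
    rw [map_mul, pderiv_mul, hp, hX]
    simp only [pderiv_mul, map_add, map_mul, mul_add, Finset.sum_add_distrib, pderiv_X,
      Pi.single_apply, Finset.sum_mul]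
    congr 1
    · exact Finset.sum_congr rfl fun i _ => by ring
    · simp [mul_ite, apply_ite (polySubst A)]
      ring

/-- Two applications of the chain rule bring in two factors of `A`; summing over the differentiation
index contracts them to `A Aᵀ = 1`. -/
theorem polyLaplacian_polySubst {A : Matrix (Fin (m + 1)) (Fin (m + 1)) ℂ} (hA : A * A.transpose = 1)
    (P : MvPolynomial (Fin (m + 1)) ℂ) :
    polyLaplacian m (polySubst A P) = polySubst A (polyLaplacian m P) := by
  simp only [polyLaplacian_apply, pderiv_polySubst, map_sum, pderiv_C_mul, Finset.mul_sum]
  rw [Finset.sum_comm]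
  refine Finset.sum_congr rfl fun i _ => ?_
  rw [Finset.sum_comm]
  have h : ∀ j, ∑ k, A i k * A j k = if i = j then 1 else 0 := fun j => by
    simpa [Matrix.mul_apply, Matrix.one_apply] using congrFun (congrFun hA i) j
  simp only [← mul_assoc, ← C_mul, ← Finset.sum_mul, ← map_sum, h]
  simp

theorem isHomogeneous_polySubst {d : ℕ} {P : MvPolynomial (Fin (m + 1)) ℂ}
    (hP : P.IsHomogeneous d) (A : Matrix (Fin (m + 1)) (Fin (m + 1)) ℂ) :
    (polySubst A P).IsHomogeneous d := by
  have := hP.aeval (fun i => ∑ j, C (A i j) * X j) (n := 1) fun i =>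
    IsHomogeneous.sum _ _ _ fun j _ => isHomogeneous_C_mul_X (A i j) j
  rwa [one_mul] at this

theorem aeval_polySubst (A : Matrix (Fin (m + 1)) (Fin (m + 1)) ℂ)
    (P : MvPolynomial (Fin (m + 1)) ℂ) (x : Fin (m + 1) → ℂ) :
    aeval x (polySubst A P) = aeval (A.mulVec x) P := by
  rw [polySubst, aeval_bind₁]
  congr 2
  ext i
  simp only [map_sum, map_mul, aeval_C, aeval_X, Matrix.mulVec, dotProduct]
  rfl

/-- The chain rule for a polynomial along a curve. -/
theorem hasDerivAt_aeval {γ γ' : ℝ → Fin (m + 1) → ℂ} {t : ℝ}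
    (h : ∀ i, HasDerivAt (fun s => γ s i) (γ' t i) t) (P : MvPolynomial (Fin (m + 1)) ℂ) :
    HasDerivAt (fun s => aeval (γ s) P) (∑ i, γ' t i * aeval (γ t) (pderiv i P)) t := by
  induction P using MvPolynomial.induction_on with
  | C a => simpa using hasDerivAt_const t a
  | add p q hp hq =>
    simpa only [map_add, mul_add, Finset.sum_add_distrib] using hp.fun_add hq
  | mul_X p l hp =>
    have := hp.fun_mul (h l)
    simp only [map_mul, aeval_X]
    convert! this using 1
    simp only [pderiv_mul, map_add, map_mul, mul_add, Finset.sum_add_distrib, pderiv_X,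
      Pi.single_apply, Finset.sum_mul, aeval_X]
    congr 1
    · exact Finset.sum_congr rfl fun i _ => by ring
    · simp [apply_ite (aeval (γ t))]
      ring

/-! ### Isometry invariance and total mass of the surface measure -/

/-- The action of a linear isometry on the sphere. -/
def sphMap (L : EuclideanSpace ℝ (Fin (m + 1)) ≃ₗᵢ[ℝ] EuclideanSpace ℝ (Fin (m + 1))) (x : Sph m) :
    Sph m :=
  ⟨L x, by simp⟩

theorem continuous_sphMap
    (L : EuclideanSpace ℝ (Fin (m + 1)) ≃ₗᵢ[ℝ] EuclideanSpace ℝ (Fin (m + 1))) :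
    Continuous (sphMap L) :=
  (L.continuous.comp continuous_subtype_val).subtype_mk _

open scoped Pointwise in
-- The measure of `s` is, up to a dimensional factor, the volume of the cone `(0,1) • s`. An
-- isometry carries cones to cones and preserves volume.
theorem measurePreserving_sphMap
    (L : EuclideanSpace ℝ (Fin (m + 1)) ≃ₗᵢ[ℝ] EuclideanSpace ℝ (Fin (m + 1))) :
    MeasurePreserving (sphMap L) (sphMeasure m) (sphMeasure m) := by
  refine ⟨(continuous_sphMap L).measurable, Measure.ext fun s hs => ?_⟩
  have hs' := (continuous_sphMap L).measurable hs
  rw [Measure.map_apply (continuous_sphMap L).measurable hs, sphMeasure,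
    Measure.toSphere_apply' _ hs, Measure.toSphere_apply' _ hs',
    ← L.measurePreserving.measure_preimage_emb L.toHomeomorph.measurableEmbedding
      (Set.Ioo (0 : ℝ) 1 • (Subtype.val '' s))]
  congr 2
  ext y
  simp only [Set.mem_smul, Set.mem_image, Set.mem_preimage]
  constructor
  · rintro ⟨r, hr, _, ⟨x, hx, rfl⟩, rfl⟩
    exact ⟨r, hr, L x, ⟨sphMap L x, hx, rfl⟩, by simp⟩
  · rintro ⟨r, hr, _, ⟨x, hx, rfl⟩, hy⟩
    refine ⟨r, hr, L.symm x, ⟨sphMap L.symm x, ?_, rfl⟩, ?_⟩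
    · rwa [show sphMap L (sphMap L.symm x) = x from Subtype.ext (by simp [sphMap])]
    · rw [← map_smul, hy, L.symm_apply_apply]

instance : IsFiniteMeasure (sphMeasure m) := inferInstanceAs (IsFiniteMeasure (Measure.toSphere _))

theorem integral_comp_sphMap
    (L : EuclideanSpace ℝ (Fin (m + 1)) ≃ₗᵢ[ℝ] EuclideanSpace ℝ (Fin (m + 1))) (f : Sph m → ℂ) :
    ∫ x, f (sphMap L x) ∂(sphMeasure m) = ∫ x, f x ∂(sphMeasure m) := by
  have hL : MeasurableEmbedding (sphMap L) := by
    let e : Sph m ≃ₜ Sph m :=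
      { toFun := sphMap L
        invFun := sphMap L.symm
        left_inv := fun x => Subtype.ext (by simp [sphMap])
        right_inv := fun x => Subtype.ext (by simp [sphMap])
        continuous_toFun := continuous_sphMap L
        continuous_invFun := continuous_sphMap L.symm }
    exact e.measurableEmbedding
  exact (measurePreserving_sphMap L).integral_comp hL f

/-- The reflection in the hyperplane orthogonal to `x - y` exchanges two vectors of equal norm. -/
theorem exists_sphMap_eq (x y : Sph m) :
    ∃ L : EuclideanSpace ℝ (Fin (m + 1)) ≃ₗᵢ[ℝ] EuclideanSpace ℝ (Fin (m + 1)), sphMap L x = y :=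
  ⟨_, Subtype.ext (Submodule.reflection_sub (v := x.1) (w := y.1) (by simp))⟩

theorem omegaSph_pos : 0 < omegaSph m := by
  unfold omegaSph
  have := Real.Gamma_pos_of_pos (s := ((m : ℝ) + 1) / 2) (by positivity)
  positivity

theorem sphMeasure_real_univ : (sphMeasure m).real Set.univ = omegaSph m := by
  rw [sphMeasure, Measure.toSphere_real_apply_univ, measureReal_def, EuclideanSpace.volume_ball]
  have hG := Real.Gamma_pos_of_pos (s := ((m : ℝ) + 1) / 2) (by positivity)
  have h1 : Real.Gamma (((m : ℝ) + 1) / 2 + 1) = ((m : ℝ) + 1) / 2 * Real.Gamma (((m : ℝ) + 1) / 2) :=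
    Real.Gamma_add_one (by positivity)
  have h2 : √Real.pi ^ (m + 1) = Real.pi ^ (((m : ℝ) + 1) / 2) := by
    rw [Real.sqrt_eq_rpow, ← Real.rpow_natCast, ← Real.rpow_mul Real.pi_pos.le]
    push_cast
    congr 1
    ring
  simp only [finrank_euclideanSpace, Fintype.card_fin, ENNReal.ofReal_one, one_pow, one_mul,
    Nat.cast_add, Nat.cast_one, h1, h2]
  rw [ENNReal.toReal_ofReal (by positivity), omegaSph]
  field_simp

/-! ### Integrating polynomials over the sphere -/

theorem restrictSph_apply (P : MvPolynomial (Fin (m + 1)) ℂ) (x : Sph m) :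
    restrictSph m P x = aeval (fun i => ((x.1 i : ℝ) : ℂ)) P := rfl

theorem restrictSph_mul (P Q : MvPolynomial (Fin (m + 1)) ℂ) :
    restrictSph m (P * Q) = restrictSph m P * restrictSph m Q := by
  ext x
  simp [restrictSph_apply]

theorem continuous_restrictSph (P : MvPolynomial (Fin (m + 1)) ℂ) :
    Continuous (restrictSph m P) := by
  change Continuous fun x : Sph m => aeval (fun i => ((x.1 i : ℝ) : ℂ)) P
  simp only [aeval_def, eval₂_eq']
  fun_prop

theorem Continuous.integrable_sph {E : Type*} [NormedAddCommGroup E] {f : Sph m → E}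
    (hf : Continuous f) : Integrable f (sphMeasure m) :=
  hf.integrable_of_hasCompactSupport (HasCompactSupport.of_compactSpace f)

theorem restrictSph_polyNormSq : restrictSph m (polyNormSq m) = 1 := by
  ext x
  have h : ∑ i, x.1 i ^ 2 = (1 : ℝ) := by
    rw [← EuclideanSpace.real_norm_sq_eq]; simp
  rw [restrictSph_apply]
  simpa [polyNormSq] using congrArg (fun r : ℝ => (r : ℂ)) h

/-- Integration of polynomials over the sphere. -/
def sphInt (m : ℕ) : MvPolynomial (Fin (m + 1)) ℂ →ₗ[ℂ] ℂ where
  toFun P := ∫ x, restrictSph m P x ∂(sphMeasure m)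
  map_add' P Q := by
    simp only [map_add, Pi.add_apply]
    exact integral_add (continuous_restrictSph P).integrable_sph
      (continuous_restrictSph Q).integrable_sph
  map_smul' c P := by
    simp only [map_smul, Pi.smul_apply, RingHom.id_apply]
    exact integral_smul c _

theorem sphInt_apply (P : MvPolynomial (Fin (m + 1)) ℂ) :
    sphInt m P = ∫ x, restrictSph m P x ∂(sphMeasure m) := rfl

theorem sphInt_polyNormSq_mul (P : MvPolynomial (Fin (m + 1)) ℂ) :
    sphInt m (polyNormSq m * P) = sphInt m P := by
  simp only [sphInt_apply, restrictSph_mul, restrictSph_polyNormSq, one_mul]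

/-- The matrix of a linear isometry, with complex entries. -/
def isometryMatrix (L : EuclideanSpace ℝ (Fin (m + 1)) ≃ₗᵢ[ℝ] EuclideanSpace ℝ (Fin (m + 1))) :
    Matrix (Fin (m + 1)) (Fin (m + 1)) ℂ :=
  Matrix.of fun i j => ((L (EuclideanSpace.single j 1) i : ℝ) : ℂ)

theorem isometryMatrix_mul_transpose
    (L : EuclideanSpace ℝ (Fin (m + 1)) ≃ₗᵢ[ℝ] EuclideanSpace ℝ (Fin (m + 1))) :
    isometryMatrix L * (isometryMatrix L).transpose = 1 := by
  rw [mul_eq_one_comm]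
  ext i j
  have h := L.inner_map_map (EuclideanSpace.single j (1 : ℝ)) (EuclideanSpace.single i (1 : ℝ))
  rw [PiLp.inner_apply] at h
  have h' := congrArg (fun r : ℝ => (r : ℂ)) h
  simp only [Matrix.mul_apply, Matrix.transpose_apply, isometryMatrix, Matrix.of_apply,
    Matrix.one_apply]
  rw [EuclideanSpace.inner_single_left] at h'
  simpa [Pi.single_apply, @eq_comm _ j i, apply_ite Complex.ofReal] using h'

theorem restrictSph_polySubst
    (L : EuclideanSpace ℝ (Fin (m + 1)) ≃ₗᵢ[ℝ] EuclideanSpace ℝ (Fin (m + 1)))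
    (P : MvPolynomial (Fin (m + 1)) ℂ) (x : Sph m) :
    restrictSph m (polySubst (isometryMatrix L) P) x = restrictSph m P (sphMap L x) := by
  rw [restrictSph_apply, restrictSph_apply, aeval_polySubst]
  congr 2
  ext i
  have h : x.1 = ∑ j, x.1 j • EuclideanSpace.single j (1 : ℝ) := by
    ext i; simp [Pi.single_apply]
  have h2 : L x.1 i = ∑ j, x.1 j * L (EuclideanSpace.single j (1 : ℝ)) i := by
    conv_lhs => rw [h]
    simp
  simp only [sphMap, h2, Matrix.mulVec, dotProduct, isometryMatrix, Matrix.of_apply]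
  push_cast
  exact Finset.sum_congr rfl fun j _ => mul_comm _ _

theorem comp_sphMap_mem_sphHarmonics {k : ℕ}
    (L : EuclideanSpace ℝ (Fin (m + 1)) ≃ₗᵢ[ℝ] EuclideanSpace ℝ (Fin (m + 1)))
    {h : Sph m → ℂ} (hh : h ∈ sphHarmonics m k) : h ∘ sphMap L ∈ sphHarmonics m k := by
  obtain ⟨P, ⟨hP1, hP2⟩, rfl⟩ := hh
  refine ⟨polySubst (isometryMatrix L) P, ⟨isHomogeneous_polySubst hP1 _, ?_⟩, ?_⟩
  · change polyLaplacian m _ = 0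
    rw [polyLaplacian_polySubst (isometryMatrix_mul_transpose L), LinearMap.mem_ker.mp hP2, map_zero]
  · ext x
    exact restrictSph_polySubst L P x

/-! ### Infinitesimal rotations and orthogonality of different degrees -/

/-- The unit vector `cos t eᵢ + sin t eⱼ`. -/
def planeVec (i j : Fin (m + 1)) (t : ℝ) : EuclideanSpace ℝ (Fin (m + 1)) :=
  Real.cos t • EuclideanSpace.single i 1 + Real.sin t • EuclideanSpace.single j 1

theorem norm_planeVec {i j : Fin (m + 1)} (hij : i ≠ j) (t : ℝ) : ‖planeVec i j t‖ = 1 := by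
  rw [← sq_eq_sq₀ (norm_nonneg _) zero_le_one, one_pow, planeVec, norm_add_sq_real]
  simp [inner_smul_left, inner_smul_right, norm_smul, EuclideanSpace.inner_single_left, hij]

/-- The reflection in the line through `planeVec i j t`. -/
def planeReflection (i j : Fin (m + 1)) (t : ℝ) :
    EuclideanSpace ℝ (Fin (m + 1)) ≃ₗᵢ[ℝ] EuclideanSpace ℝ (Fin (m + 1)) :=
  (Submodule.span ℝ {planeVec i j t}).reflection

theorem planeReflection_apply {i j : Fin (m + 1)} (hij : i ≠ j) (t : ℝ)
    (y : EuclideanSpace ℝ (Fin (m + 1))) (k : Fin (m + 1)) :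
    planeReflection i j t y k = 2 * (Real.cos t * y i + Real.sin t * y j) *
      (Real.cos t * (if k = i then 1 else 0) + Real.sin t * (if k = j then 1 else 0)) - y k := by
  rw [planeReflection, Submodule.reflection_apply,
    Submodule.starProjection_unit_singleton ℝ (norm_planeVec hij t)]
  have h : inner ℝ (planeVec i j t) y = Real.cos t * y i + Real.sin t * y j := by
    simp [planeVec, inner_add_left, inner_smul_left, EuclideanSpace.inner_single_left]
  rw [h]
  simp [planeVec]
  split_ifs <;> ring

/-- Moving the line by an angle `s` composes the reflection with the rotation by `2s` in the `(i,
j)` plane. Hence the derivative is twice the infinitesimal rotation `xᵢ∂ⱼ - xⱼ∂ᵢ`, evaluated at the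
reflected point. -/
theorem hasDerivAt_restrictSph_planeReflection {i j : Fin (m + 1)} (hij : i ≠ j)
    (P : MvPolynomial (Fin (m + 1)) ℂ) (y : Sph m) (t : ℝ) :
    HasDerivAt (fun s => restrictSph m P (sphMap (planeReflection i j s) y))
      (restrictSph m (C 2 * (X i * pderiv j P - X j * pderiv i P))
        (sphMap (planeReflection i j t) y)) t := by
  have key : ∀ k, HasDerivAt
      (fun s => ((planeReflection i j s y.1 k : ℝ) : ℂ))
      ((2 * (planeReflection i j t y.1 i * (if k = j then 1 else 0) -
        planeReflection i j t y.1 j * (if k = i then 1 else 0)) : ℝ) : ℂ) t := by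
    intro k
    refine HasDerivAt.ofReal_comp ?_
    simp only [planeReflection_apply hij]
    have hc := Real.hasDerivAt_cos t
    have hs := Real.hasDerivAt_sin t
    have := (((((hc.mul_const (y.1 i)).add (hs.mul_const (y.1 j))).const_mul 2).mul
      ((hc.mul_const (if k = i then (1 : ℝ) else 0)).add
        (hs.mul_const (if k = j then (1 : ℝ) else 0)))).sub_const (y.1 k))
    convert! this using 1
    have h1 := Real.sin_sq_add_cos_sq t
    simp only [if_true, hij, hij.symm, if_false, Pi.add_apply]
    split_ifs with h2 h3 h3
    · exact absurd (h3.symm.trans h2) hij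
    · linear_combination (2 * y.1 i) * h1
    · linear_combination (-2 * y.1 j) * h1
    · ring
  have h := hasDerivAt_aeval (γ := fun s k => ((planeReflection i j s y.1 k : ℝ) : ℂ))
    (γ' := fun t k => ((2 * (planeReflection i j t y.1 i * (if k = j then 1 else 0) -
        planeReflection i j t y.1 j * (if k = i then 1 else 0)) : ℝ) : ℂ)) key P
  convert! h using 1
  rw [restrictSph_apply]
  simp only [map_mul, map_sub, aeval_X, aeval_C, sphMap]
  push_cast
  simp only [mul_sub, sub_mul, Finset.sum_sub_distrib]
  simp [mul_assoc, apply_ite Complex.ofReal]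

/-- Integrals of polynomials in the image of an infinitesimal rotation vanish. -/
theorem sphInt_rotation (i j : Fin (m + 1)) (P : MvPolynomial (Fin (m + 1)) ℂ) :
    sphInt m (X i * pderiv j P - X j * pderiv i P) = 0 := by
  rcases eq_or_ne i j with rfl | hij
  · simp
  set D : MvPolynomial (Fin (m + 1)) ℂ := C 2 * (X i * pderiv j P - X j * pderiv i P) with hD
  obtain ⟨B, hB⟩ : ∃ B, ∀ x, ‖restrictSph m D x‖ ≤ B :=
    (continuous_restrictSph D).bounded_above_of_compact_support (HasCompactSupport.of_compactSpace _)
  have h := hasDerivAt_integral_of_dominated_loc_of_deriv_le (μ := sphMeasure m)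
    (F := fun (s : ℝ) y => restrictSph m P (sphMap (planeReflection i j s) y))
    (F' := fun (s : ℝ) y => restrictSph m D (sphMap (planeReflection i j s) y))
    (x₀ := (0 : ℝ)) (s := Set.univ) (bound := fun _ => B) Filter.univ_mem
    (.of_forall fun s =>
      ((continuous_restrictSph P).comp (continuous_sphMap _)).aestronglyMeasurable)
    ((continuous_restrictSph P).comp (continuous_sphMap _)).integrable_sph
    ((continuous_restrictSph D).comp (continuous_sphMap _)).aestronglyMeasurable
    (.of_forall fun y s _ => hB _) (integrable_const _)
    (.of_forall fun y s _ => hasDerivAt_restrictSph_planeReflection hij P y s)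
  have h2 := h.2
  -- By invariance the integral does not depend on `s`, so its derivative `∫ D` is zero.
  simp only [integral_comp_sphMap] at h2
  have h3 : sphInt m D = 0 := h2.unique (hasDerivAt_const _ _)
  rw [hD, ← smul_eq_C_mul, map_smul, smul_eq_mul] at h3
  simpa using h3

/-- Summing the infinitesimal rotations of `xᵢ ∂ⱼP` over all `i`, `j` gives `|x|² ΔP - d(d+m-1) P`.
The integral of that sum vanishes, and `|x|² = 1` on the sphere. -/
theorem sphInt_polyLaplacian {d : ℕ} {P : MvPolynomial (Fin (m + 1)) ℂ} (hP : P.IsHomogeneous d) :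
    sphInt m (polyLaplacian m P) = (d * (d + m - 1) : ℂ) * sphInt m P := by
  have hE := hP.sum_X_mul_pderiv
  -- Second-order Euler identity `∑ xᵢxⱼ∂ᵢ∂ⱼP = d(d-1)P`, arranged to avoid natural subtraction.
  have hEE : ∑ i, ∑ j, X j * (X i * pderiv i (pderiv j P)) + d • P = (d * d) • P := by
    have h1 : ∀ i, X i * pderiv i (∑ j, X j * pderiv j P) =
        ∑ j, X j * (X i * pderiv i (pderiv j P)) + X i * pderiv i P := fun i => by
      have h0 : ∀ j, X i * pderiv i (X j * pderiv j P) = X j * (X i * pderiv i (pderiv j P)) +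
          (if j = i then X i * pderiv j P else 0) := fun j => by
        simp only [pderiv_mul, pderiv_X, Pi.single_apply]
        split_ifs <;> ring
      simp only [map_sum, Finset.mul_sum, h0, Finset.sum_add_distrib, Finset.sum_ite_eq',
        Finset.mem_univ, if_true]
    have h2 := Finset.sum_congr rfl fun i (_ : i ∈ Finset.univ) => h1 i
    rw [Finset.sum_add_distrib, hE] at h2
    rw [← h2]
    simp only [map_nsmul, mul_smul_comm, ← Finset.smul_sum, hE, smul_smul]
  have key : ∑ i : Fin (m + 1), ∑ j, (X i * pderiv j (X i * pderiv j P) -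
      X j * pderiv i (X i * pderiv j P)) =
      polyNormSq m * polyLaplacian m P - (d * (d + m - 1) : ℂ) • P := by
    have h1 : ∀ i j : Fin (m + 1), X i * pderiv j (X i * pderiv j P) -
        X j * pderiv i (X i * pderiv j P) =
        (if i = j then X i * pderiv j P else 0) + X i ^ 2 * pderiv j (pderiv j P) -
        X j * pderiv j P - X j * (X i * pderiv i (pderiv j P)) := fun i j => by
      simp only [pderiv_mul, pderiv_X, Pi.single_apply, if_true]
      split_ifs <;> ring
    simp only [h1, Finset.sum_sub_distrib, Finset.sum_add_distrib]
    rw [← eq_sub_iff_add_eq] at hEE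
    have hN : ∑ i, X i ^ 2 = polyNormSq m := rfl
    rw [hEE]
    simp only [Finset.sum_ite_eq, Finset.mem_univ, if_true, hE, ← Finset.mul_sum, ← Finset.sum_mul,
      ← polyLaplacian_apply, hN, Finset.sum_const, Finset.card_univ, Fintype.card_fin]
    simp only [smul_eq_C_mul, nsmul_eq_mul, map_mul, map_add, map_sub, map_one, map_natCast]
    push_cast
    ring
  have h := congrArg (sphInt m) key
  simp only [map_sum, sphInt_rotation, Finset.sum_const_zero] at h
  rw [map_sub, sphInt_polyNormSq_mul, map_smul, smul_eq_mul] at h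
  exact (sub_eq_zero.mp h.symm)

/-- Harmonic polynomials of different degrees are orthogonal on the sphere. -/
theorem sphInt_mul_eq_zero (hm : 1 ≤ m) {k l : ℕ} (hkl : k < l) {P Q : MvPolynomial (Fin (m + 1)) ℂ}
    (hP : P.IsHomogeneous k) (hQ : Q.IsHomogeneous l) (hP' : polyLaplacian m P = 0)
    (hQ' : polyLaplacian m Q = 0) : sphInt m (P * Q) = 0 := by
  induction k generalizing l P Q with
  | zero =>
    have h := sphInt_polyLaplacian (hP.mul hQ)
    rw [polyLaplacian_mul, hP', hQ'] at h
    simp only [pderiv_eq_zero_of_isHomogeneous_zero hP] at h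
    simp only [mul_zero, zero_mul, Finset.sum_const_zero, add_zero, map_zero] at h
    refine (mul_eq_zero.mp h.symm).resolve_left ?_
    have : (0 : ℝ) < l := by exact_mod_cast hkl
    have h1 : (1 : ℝ) ≤ m := by exact_mod_cast hm
    have h2 : (0 : ℝ) < (((0 + l : ℕ) : ℝ) * ((0 + l : ℕ) + m - 1)) := by
      push_cast; rw [zero_add]; exact mul_pos this (by linarith)
    exact_mod_cast h2.ne'
  | succ k ih =>
    have h := sphInt_polyLaplacian (hP.mul hQ)
    -- For harmonic `P`, `Q` only `2 ∑ ∂ᵢP ∂ᵢQ` remains of `Δ(PQ)`. Its factors are again harmonic,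
    -- of degrees `k` and `l - 1`, so the induction hypothesis kills its integral; the nonzero
    -- factor in `sphInt_polyLaplacian` then forces `∫ PQ = 0`.
    have h0 : ∀ i : Fin (m + 1), sphInt m (pderiv i P * pderiv i Q) = 0 := fun i => by
      refine ih (l := l - 1) (by omega) (by simpa using hP.pderiv (i := i)) hQ.pderiv ?_ ?_
      · rw [polyLaplacian_pderiv, hP', map_zero]
      · rw [polyLaplacian_pderiv, hQ', map_zero]
    rw [polyLaplacian_mul, hP', hQ', mul_zero, zero_mul, zero_add, zero_add, two_mul, map_add,
      map_sum, Finset.sum_eq_zero fun i _ => h0 i, add_zero] at h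
    refine (mul_eq_zero.mp h.symm).resolve_left ?_
    have : (0 : ℝ) < l := by exact_mod_cast (by omega : 0 < l)
    have h1 : (1 : ℝ) ≤ m := by exact_mod_cast hm
    have h2 : (0 : ℝ) < (((k + 1 + l : ℕ) : ℝ) * ((k + 1 + l : ℕ) + m - 1)) := by
      push_cast; exact mul_pos (by positivity) (by nlinarith [Nat.cast_nonneg (α := ℝ) k])
    exact_mod_cast h2.ne'

/-- The complex conjugate of a polynomial. -/
def polyConj (P : MvPolynomial (Fin (m + 1)) ℂ) : MvPolynomial (Fin (m + 1)) ℂ :=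
  MvPolynomial.map (starRingEnd ℂ) P

theorem restrictSph_polyConj (P : MvPolynomial (Fin (m + 1)) ℂ) (x : Sph m) :
    restrictSph m (polyConj P) x = starRingEnd ℂ (restrictSph m P x) := by
  rw [restrictSph_apply, restrictSph_apply, polyConj, aeval_def, eval₂_map, aeval_def, hom_eval₂]
  congr 1
  ext i
  simp

theorem polyLaplacian_polyConj (P : MvPolynomial (Fin (m + 1)) ℂ) :
    polyLaplacian m (polyConj P) = polyConj (polyLaplacian m P) := by
  simp [polyLaplacian_apply, polyConj, pderiv_map]

theorem sphHarmonics_orthogonal (hm : 1 ≤ m) {k l : ℕ} (hkl : k ≠ l) {f g : Sph m → ℂ}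
    (hf : f ∈ sphHarmonics m k) (hg : g ∈ sphHarmonics m l) :
    ∫ x, f x * starRingEnd ℂ (g x) ∂(sphMeasure m) = 0 := by
  obtain ⟨P, ⟨hP1, hP2⟩, rfl⟩ := hf
  obtain ⟨Q, ⟨hQ1, hQ2⟩, rfl⟩ := hg
  have hP2' := LinearMap.mem_ker.mp hP2
  have hQ1' : (polyConj Q).IsHomogeneous l := IsHomogeneous.map hQ1 _
  have hQ2' : polyLaplacian m (polyConj Q) = 0 := by
    rw [polyLaplacian_polyConj, LinearMap.mem_ker.mp hQ2, polyConj, map_zero]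
  have : sphInt m (P * polyConj Q) = 0 := by
    rcases lt_or_gt_of_ne hkl with h | h
    · exact sphInt_mul_eq_zero hm h hP1 hQ1' hP2' hQ2'
    · rw [mul_comm]
      exact sphInt_mul_eq_zero hm h hQ1' hP1 hQ2' hP2'
  rw [sphInt_apply, restrictSph_mul] at this
  simpa only [Pi.mul_apply, restrictSph_polyConj] using this

theorem continuous_of_mem_sphHarmonics {k : ℕ} {f : Sph m → ℂ} (hf : f ∈ sphHarmonics m k) :
    Continuous f := by
  obtain ⟨P, -, rfl⟩ := hf
  exact continuous_restrictSph P

/-- On the sphere every polynomial is a sum of spherical harmonics. -/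
theorem restrictSph_mem_iSup_sphHarmonics (P : MvPolynomial (Fin (m + 1)) ℂ) :
    restrictSph m P ∈ ⨆ k, sphHarmonics m k := by
  have key : ∀ d : ℕ, ∀ P : MvPolynomial (Fin (m + 1)) ℂ, P.IsHomogeneous d →
      restrictSph m P ∈ ⨆ k, sphHarmonics m k := by
    intro d
    induction d using Nat.strong_induction_on with
    | _ d ih =>
      intro P hP
      obtain hd | ⟨e, rfl⟩ : d < 2 ∨ ∃ e, d = e + 2 := by
        rcases lt_or_ge d 2 with h | h
        · exact .inl h
        · exact .inr ⟨d - 2, by omega⟩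
      · exact Submodule.mem_iSup_of_mem d
          ⟨P, ⟨hP, polyLaplacian_eq_zero_of_isHomogeneous hP hd⟩, rfl⟩
      · obtain ⟨H, Q, hH, hH', hQ, rfl⟩ := exists_harmonic_add_polyNormSq_mul hP
        rw [map_add, restrictSph_mul, restrictSph_polyNormSq, one_mul]
        exact Submodule.add_mem _ (Submodule.mem_iSup_of_mem (e + 2) ⟨H, ⟨hH, hH'⟩, rfl⟩)
          (ih e (by omega) Q hQ)
  rw [← sum_homogeneousComponent P, map_sum]
  exact Submodule.sum_mem _ fun d _ => key d _ (homogeneousComponent_isHomogeneous d P)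

end

noncomputable section

/-! ### Riesz–Thorin interpolation by the three lines theorem -/

section Interpolation

open Complex

/-- The analytic family `r ^ (p (1 - z / 2))` of powers of a nonnegative real. -/
def interpPow (p : ℝ) (z : ℂ) (r : ℝ) : ℂ := (r : ℂ) ^ ((p : ℂ) * (1 - z / 2))

theorem interp_exponent_re (p : ℝ) (z : ℂ) :
    ((p : ℂ) * (1 - z / 2)).re = p * (1 - z.re / 2) := by
  rw [re_ofReal_mul]
  simp

theorem interp_exponent_pos {p : ℝ} (hp : 0 < p) {z : ℂ} (hz : z.re ≤ 1) :
    0 < p * (1 - z.re / 2) := mul_pos hp (by linarith)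

theorem norm_interpPow {p : ℝ} (hp : 0 < p) {z : ℂ} (hz : z.re ≤ 1) {r : ℝ} (hr : 0 ≤ r) :
    ‖interpPow p z r‖ = r ^ (p * (1 - z.re / 2)) := by
  have h := interp_exponent_pos hp hz
  rw [interpPow, norm_cpow_eq_rpow_re_of_nonneg hr, interp_exponent_re]
  rw [interp_exponent_re]
  exact h.ne'

theorem norm_interpPow_le {p : ℝ} (hp : 0 < p) {z : ℂ} (hz0 : 0 ≤ z.re) (hz : z.re ≤ 1) {r : ℝ}
    (hr : 0 ≤ r) : ‖interpPow p z r‖ ≤ (1 + r) ^ p := by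
  rw [norm_interpPow hp hz hr]
  calc r ^ (p * (1 - z.re / 2)) ≤ (1 + r) ^ (p * (1 - z.re / 2)) :=
        Real.rpow_le_rpow hr (by linarith) (interp_exponent_pos hp hz).le
    _ ≤ (1 + r) ^ p := Real.rpow_le_rpow_of_exponent_le (by linarith) (by nlinarith)

/-- The base may be `0`: the exponent has positive real part for `z.re ≤ 1`, hence is nonzero, which
is all that a constant base requires. The boundary line `re z = 1` is included. -/
theorem differentiableAt_interpPow {p : ℝ} (hp : 0 < p) {z : ℂ} (hz : z.re ≤ 1) (r : ℝ) :
    DifferentiableAt ℂ (fun z => interpPow p z r) z := by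
  refine DifferentiableAt.const_cpow (by fun_prop) (Or.inr fun h => ?_)
  have := congrArg re h
  rw [interp_exponent_re] at this
  exact (interp_exponent_pos hp hz).ne' this

theorem interpPow_of_eq_one {p : ℝ} {z : ℂ} (hz : (p : ℂ) * (1 - z / 2) = 1) (r : ℝ) :
    interpPow p z r = r := by
  rw [interpPow, hz, cpow_one]

variable {V K : Type*}

/-- The analytic family `|h| ^ (p (1 - z / 2)) sgn h` through a function `h`. -/
def interpFun (p : ℝ) (h : V → ℂ) (z : ℂ) : V → ℂ :=
  fun v => interpPow p z ‖h v‖ * (h v / ‖h v‖)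

theorem norm_interpFun {p : ℝ} (hp : 0 < p) (h : V → ℂ) {z : ℂ} (hz : z.re ≤ 1) (v : V) :
    ‖interpFun p h z v‖ = ‖h v‖ ^ (p * (1 - z.re / 2)) := by
  rw [interpFun, norm_mul, norm_interpPow hp hz (norm_nonneg _)]
  rcases eq_or_ne (h v) 0 with h0 | h0
  · simp [h0, (interp_exponent_pos hp hz).ne']
  · simp [h0]

theorem norm_interpFun_le {p : ℝ} (hp : 0 < p) (h : V → ℂ) {z : ℂ} (hz0 : 0 ≤ z.re)
    (hz : z.re ≤ 1) (v : V) : ‖interpFun p h z v‖ ≤ (1 + ‖h v‖) ^ p := by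
  rw [norm_interpFun hp h hz, ← norm_interpPow hp hz (norm_nonneg _)]
  exact norm_interpPow_le hp hz0 hz (norm_nonneg _)

theorem interpFun_of_eq_one {p : ℝ} {z : ℂ} (hz : (p : ℂ) * (1 - z / 2) = 1) (h : V → ℂ) :
    interpFun p h z = h := by
  ext v
  rw [interpFun, interpPow_of_eq_one hz]
  rcases eq_or_ne (h v) 0 with h0 | h0
  · simp [h0]
  · exact mul_div_cancel₀ _ (by simpa using h0)

variable [Fintype K]

theorem sum_sqrt_mul_interpPow_le {E : K → Type*} [∀ k, NormedAddCommGroup (E k)]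
    [∀ k, NormedSpace ℂ (E k)] (d b : K → ℝ) (w : ∀ k, E k) (ℓ : ∀ k, E k →L[ℂ] ℂ)
    (hℓ : ∀ k, ‖ℓ k‖ ≤ 1) (p : ℝ) (z : ℂ) :
    ‖∑ k, (√(d k) : ℂ) * interpPow p z (b k) * ℓ k (w k)‖ ≤
      ∑ k, √(d k) * ‖interpPow p z (b k)‖ * ‖w k‖ := by
  refine (norm_sum_le _ _).trans (Finset.sum_le_sum fun k _ => ?_)
  rw [norm_mul, norm_mul, norm_real, Real.norm_of_nonneg (Real.sqrt_nonneg _)]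
  gcongr
  exact ((ℓ k).le_opNorm _).trans (by nlinarith [hℓ k, norm_nonneg (w k)])

variable [Fintype V]

/-- Three lines theorem for a family of operators bounded `L¹ → ℓ^∞` and `L² → ℓ²`, tested against
a dual sequence `b`. -/
theorem norm_dual_pairing_le {E : K → Type*} [∀ k, NormedAddCommGroup (E k)]
    [∀ k, NormedSpace ℂ (E k)] {μ : V → ℝ} (hμ : ∀ v, 0 ≤ μ v) {d : K → ℝ} (hd : ∀ k, 0 ≤ d k)
    {C : ℝ} (hC : 0 ≤ C) (T : ∀ k, (V → ℂ) →ₗ[ℂ] E k)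
    (h1 : ∀ h k, ‖T k h‖ ≤ C * √(d k) * ∑ v, μ v * ‖h v‖)
    (h2 : ∀ h, ∑ k, ‖T k h‖ ^ 2 ≤ ∑ v, μ v * ‖h v‖ ^ 2)
    {p q : ℝ} (hp : 1 < p) (hp2 : p ≤ 2) (hpq : p.HolderConjugate q) (h : V → ℂ)
    {b : K → ℝ} (hb : ∀ k, 0 ≤ b k) :
    ∑ k, √(d k) * b k * ‖T k h‖ ≤
      (C * (∑ k, d k * b k ^ p) * ∑ v, μ v * ‖h v‖ ^ p) ^ (1 - 2 / q) *
      (√(∑ k, d k * b k ^ p) * √(∑ v, μ v * ‖h v‖ ^ p)) ^ (2 / q) := by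
  have hp0 : 0 < p := by linarith
  have hq0 : 0 < q := hpq.symm.pos
  have hinv : 1 / p + 1 / q = 1 := by simpa using hpq.inv_add_inv_eq_one
  have hq2 : 2 ≤ q := by
    have : 1 / 2 ≤ 1 / p := one_div_le_one_div_of_le hp0 hp2
    have : 1 / q ≤ 1 / 2 := by linarith
    exact (one_div_le_one_div hq0 (by norm_num)).mp this
  -- Norming functionals make `F` analytic while recovering `‖T k h‖` at the point of interest.
  choose ℓ hℓ hℓ' using fun k => exists_dual_vector'' ℂ (T k h)
  set F : ℂ → ℂ := fun z =>
    ∑ k, (√(d k) : ℂ) * interpPow p z (b k) * ℓ k (T k (interpFun p h z)) with hF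
  have hFle : ∀ z, ‖F z‖ ≤ ∑ k, √(d k) * ‖interpPow p z (b k)‖ * ‖T k (interpFun p h z)‖ :=
    fun z => sum_sqrt_mul_interpPow_le d b (fun k => T k (interpFun p h z)) ℓ hℓ p z
  -- At `θ = 2/q` the exponent `p(1 - θ/2)` equals `1`, so both analytic families return the
  -- original data.
  set θ : ℂ := ((2 / q : ℝ) : ℂ) with hθ
  have hθre : θ.re = 2 / q := ofReal_re _
  have hθ1 : (p : ℂ) * (1 - θ / 2) = 1 := by
    have : p * (1 - 2 / q / 2) = 1 := by
      have : 1 - 2 / q / 2 = 1 / p := by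
        have : 2 / q / 2 = 1 / q := by ring
        linarith
      rw [this]; field_simp
    rw [hθ]; exact_mod_cast this
  have hFθ : F θ = ((∑ k, √(d k) * b k * ‖T k h‖ : ℝ) : ℂ) := by
    simp only [hF, interpPow_of_eq_one hθ1, interpFun_of_eq_one hθ1, hℓ']
    push_cast
    rfl
  have hdiff : DiffContOnCl ℂ F (HadamardThreeLines.verticalStrip 0 1) := by
    refine DifferentiableOn.diffContOnCl fun z hz => DifferentiableAt.differentiableWithinAt ?_
    have hz' : z.re ≤ 1 := by
      rw [HadamardThreeLines.verticalStrip, closure_preimage_re, closure_Ioo zero_ne_one] at hz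
      exact hz.2
    refine DifferentiableAt.fun_sum fun k _ => ?_
    refine ((differentiableAt_const _).mul (differentiableAt_interpPow hp0 hz' _)).mul ?_
    have hfun : DifferentiableAt ℂ (interpFun p h) z :=
      differentiableAt_pi.mpr fun v =>
        (differentiableAt_interpPow hp0 hz' _).mul (differentiableAt_const _)
    exact (LinearMap.toContinuousLinearMap ((ℓ k : E k →ₗ[ℂ] ℂ) ∘ₗ T k)).differentiableAt.comp z hfun
  have hbdd : BddAbove ((norm ∘ F) '' HadamardThreeLines.verticalClosedStrip 0 1) := by
    refine ⟨∑ k, √(d k) * (1 + b k) ^ p * (C * √(d k) * ∑ v, μ v * (1 + ‖h v‖) ^ p), ?_⟩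
    rintro _ ⟨z, ⟨hz0, hz1⟩, rfl⟩
    refine (hFle z).trans (Finset.sum_le_sum fun k _ => ?_)
    have := hb k
    refine mul_le_mul (mul_le_mul_of_nonneg_left (norm_interpPow_le hp0 hz0 hz1 (hb k))
      (Real.sqrt_nonneg _)) ((h1 _ k).trans ?_) (norm_nonneg _) (by positivity)
    gcongr with v
    · exact hμ v
    · exact norm_interpFun_le hp0 h hz0 hz1 v
  have hleft : ∀ z ∈ re ⁻¹' {0}, ‖F z‖ ≤ C * (∑ k, d k * b k ^ p) * ∑ v, μ v * ‖h v‖ ^ p := by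
    intro z hz
    have hz : z.re = 0 := hz
    have hz1 : z.re ≤ 1 := by linarith
    refine (hFle z).trans ?_
    rw [mul_comm C, mul_assoc, Finset.sum_mul]
    refine Finset.sum_le_sum fun k _ => ?_
    rw [norm_interpPow hp0 hz1 (hb k), hz]
    have h3 := h1 (interpFun p h z) k
    simp only [norm_interpFun hp0 h hz1, hz, zero_div, sub_zero, mul_one] at h3 ⊢
    calc √(d k) * b k ^ p * ‖T k (interpFun p h z)‖
        ≤ √(d k) * b k ^ p * (C * √(d k) * ∑ v, μ v * ‖h v‖ ^ p) :=
          mul_le_mul_of_nonneg_left h3 (mul_nonneg (Real.sqrt_nonneg _) (Real.rpow_nonneg (hb k) _))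
      _ = (√(d k) * √(d k)) * b k ^ p * (C * ∑ v, μ v * ‖h v‖ ^ p) := by ring
      _ = _ := by rw [Real.mul_self_sqrt (hd k)]
  have hright : ∀ z ∈ re ⁻¹' {1},
      ‖F z‖ ≤ √(∑ k, d k * b k ^ p) * √(∑ v, μ v * ‖h v‖ ^ p) := by
    intro z hz
    have hz : z.re = 1 := hz
    have hsq : ∀ r : ℝ, 0 ≤ r → (r ^ (p * (1 - z.re / 2))) ^ 2 = r ^ p := fun r hr => by
      rw [← Real.rpow_natCast, ← Real.rpow_mul hr, hz]
      congr 1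
      push_cast
      ring
    refine (hFle z).trans ((Real.sum_mul_le_sqrt_mul_sqrt _ _ _).trans ?_)
    gcongr with k
    · rw [mul_pow, Real.sq_sqrt (hd k), norm_interpPow hp0 hz.le (hb k), hsq _ (hb k)]
    · refine (h2 _).trans (le_of_eq (Finset.sum_congr rfl fun v _ => ?_))
      rw [norm_interpFun hp0 h hz.le, hsq _ (norm_nonneg _)]
  have hmem : θ ∈ HadamardThreeLines.verticalClosedStrip 0 1 := by
    refine ⟨?_, ?_⟩
    · rw [hθre]; positivity
    · rw [hθre, div_le_one hq0]; exact hq2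
  have key := HadamardThreeLines.norm_le_interp_of_mem_verticalClosedStrip₀₁' F hmem hdiff hbdd
    hleft hright
  rw [hθre, hFθ, norm_real] at key
  exact (le_abs_self _).trans key

/-- **Riesz–Thorin interpolation** on a finite measure space, between a weighted `L¹ → ℓ^∞` bound
and an `L² → ℓ²` bound. -/
theorem sum_rpow_le_of_interpolation {E : K → Type*} [∀ k, NormedAddCommGroup (E k)]
    [∀ k, NormedSpace ℂ (E k)] {μ : V → ℝ} (hμ : ∀ v, 0 ≤ μ v) {d : K → ℝ} (hd : ∀ k, 0 ≤ d k)
    {C : ℝ} (hC : 0 ≤ C) (T : ∀ k, (V → ℂ) →ₗ[ℂ] E k)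
    (h1 : ∀ h k, ‖T k h‖ ≤ C * √(d k) * ∑ v, μ v * ‖h v‖)
    (h2 : ∀ h, ∑ k, ‖T k h‖ ^ 2 ≤ ∑ v, μ v * ‖h v‖ ^ 2)
    {p q : ℝ} (hp : 1 < p) (hp2 : p ≤ 2) (hpq : p.HolderConjugate q) (h : V → ℂ) :
    (∑ k, (d k ^ ((2 - q) / (2 * q)) * ‖T k h‖) ^ q) ^ (1 / q) ≤
      C ^ ((2 - p) / p) * (∑ v, μ v * ‖h v‖ ^ p) ^ (1 / p) := by
  have hp0 : 0 < p := by linarith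
  have hq0 : 0 < q := hpq.symm.pos
  have hinv : 1 / p + 1 / q = 1 := by simpa using hpq.inv_add_inv_eq_one
  set c : K → ℝ := fun k => (d k ^ ((2 - q) / (2 * q)) * ‖T k h‖) ^ q with hc
  have hc0 : ∀ k, 0 ≤ c k := fun k =>
    Real.rpow_nonneg (mul_nonneg (Real.rpow_nonneg (hd k) _) (norm_nonneg _)) _
  -- A zero weight forces `T k h = 0` by the `L¹` bound, so the convention `c k / 0 = 0` below does
  -- no harm.
  have hcd : ∀ k, d k = 0 → c k = 0 := fun k hk => by
    have : ‖T k h‖ ≤ 0 := by simpa [hk] using h1 h k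
    simp [hc, le_antisymm this (norm_nonneg _), hq0.ne']
  have hG0 : 0 ≤ ∑ v, μ v * ‖h v‖ ^ p :=
    Finset.sum_nonneg fun v _ => mul_nonneg (hμ v) (Real.rpow_nonneg (norm_nonneg _) _)
  set G := ∑ v, μ v * ‖h v‖ ^ p with hG
  -- The extremal dual sequence: both `d b^p` and `√d b ‖T h‖` equal `c`, so the duality bound
  -- becomes an inequality for `S = ∑ c` alone, namely `S ≤ C^((2-p)/p) G^(1/p) S^(1/p)`.
  set b : K → ℝ := fun k => (c k / d k) ^ (1 / p) with hb
  have hb0 : ∀ k, 0 ≤ b k := fun k => Real.rpow_nonneg (div_nonneg (hc0 k) (hd k)) _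
  have hdb : ∀ k, d k * b k ^ p = c k := fun k => by
    rcases eq_or_ne (d k) 0 with hk | hk
    · rw [hk, hcd k hk, zero_mul]
    · rw [hb]
      simp only
      rw [← Real.rpow_mul (div_nonneg (hc0 k) (hd k)), one_div_mul_cancel hp0.ne', Real.rpow_one,
        mul_div_cancel₀ _ hk]
  have hdT : ∀ k, √(d k) * b k * ‖T k h‖ = c k := fun k => by
    rcases (hd k).eq_or_lt with hk | hk
    · rw [hcd k hk.symm, ← hk]; simp
    · have hT : ‖T k h‖ = c k ^ (1 / q) * d k ^ (1 / 2 - 1 / q) := by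
        have h3 : c k ^ (1 / q) = d k ^ ((2 - q) / (2 * q)) * ‖T k h‖ := by
          rw [hc]
          simp only
          rw [← Real.rpow_mul (mul_nonneg (Real.rpow_nonneg (hd k) _) (norm_nonneg _)),
            mul_one_div_cancel hq0.ne', Real.rpow_one]
        rw [h3, mul_right_comm, ← Real.rpow_add hk,
          show (2 - q) / (2 * q) + (1 / 2 - 1 / q) = 0 by field_simp; ring, Real.rpow_zero, one_mul]
      rw [hT, hb]
      simp only
      rw [Real.sqrt_eq_rpow, Real.div_rpow (hc0 k) (hd k)]
      rcases (hc0 k).eq_or_lt with hck | hck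
      · rw [← hck, Real.zero_rpow (by positivity)]; simp
      · calc d k ^ (1 / 2 : ℝ) * (c k ^ (1 / p) / d k ^ (1 / p)) *
              (c k ^ (1 / q) * d k ^ (1 / 2 - 1 / q))
            = (c k ^ (1 / p) * c k ^ (1 / q)) *
              (d k ^ (1 / 2 : ℝ) * d k ^ (1 / 2 - 1 / q) / d k ^ (1 / p)) := by ring
          _ = c k := by
            rw [← Real.rpow_add hck, hinv, Real.rpow_one, ← Real.rpow_add hk, ← Real.rpow_sub hk,
              show (1 / 2 : ℝ) + (1 / 2 - 1 / q) - 1 / p = 0 by linarith, Real.rpow_zero, mul_one]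
  have key := norm_dual_pairing_le hμ hd hC T h1 h2 hp hp2 hpq h hb0
  simp only [hdb, hdT, ← hG] at key
  have hS0 : 0 ≤ ∑ k, c k := Finset.sum_nonneg fun k _ => hc0 k
  set S := ∑ k, c k
  have e1 : 1 - 2 / q = (2 - p) / p := by
    have : 2 / q = 2 * (1 / q) := by ring
    rw [this, sub_div, div_self hp0.ne']
    have : 2 / p = 2 * (1 / p) := by ring
    linarith
  have e2 : (1 - 2 / q) + 2 / q / 2 = 1 / p := by
    have : 2 / q = 2 * (1 / q) := by ring
    linarith
  rcases hS0.eq_or_lt with hS | hS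
  · rw [← hS, Real.zero_rpow (by positivity)]
    exact mul_nonneg (Real.rpow_nonneg hC _) (Real.rpow_nonneg hG0 _)
  rcases hG0.eq_or_lt with hG' | hG'
  · exfalso
    rw [← hG', Real.sqrt_zero, mul_zero, mul_zero,
      Real.zero_rpow (x := 2 / q) (by positivity), mul_zero] at key
    linarith
  have hrhs : (C * S * G) ^ (1 - 2 / q) * (√S * √G) ^ (2 / q) =
      C ^ ((2 - p) / p) * G ^ (1 / p) * S ^ (1 / p) := by
    have h4 : ∀ r : ℝ, 0 < r → r ^ (1 - 2 / q) * √r ^ (2 / q) = r ^ (1 / p) := fun r hr => by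
      rw [Real.sqrt_eq_rpow, ← Real.rpow_mul hr.le, ← Real.rpow_add hr, ← e2]
      congr 1
      ring
    rw [Real.mul_rpow (by positivity) hG0, Real.mul_rpow hC hS0,
      Real.mul_rpow (Real.sqrt_nonneg _) (Real.sqrt_nonneg _), ← h4 S hS, ← h4 G hG', ← e1]
    ring
  rw [hrhs] at key
  have h5 : S ^ (1 / q) * S ^ (1 / p) = S := by
    rw [← Real.rpow_add hS, add_comm, hinv, Real.rpow_one]
  have h6 : 0 < S ^ (1 / p) := Real.rpow_pos_of_pos hS _
  refine le_of_mul_le_mul_right ?_ h6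
  rw [h5]
  exact key

end Interpolation

end

noncomputable section

variable {m : ℕ}

/-! ### The addition theorem on the diagonal and the `L¹` endpoint -/

section Christoffel

variable {Y : (k : ℕ) → Fin (dimHarmonics m k) → Sph m → ℂ}

theorem IsHarmonicONB.mem {k : ℕ} {Z : Fin (dimHarmonics m k) → Sph m → ℂ}
    (hZ : IsHarmonicONB m k Z) (j : Fin (dimHarmonics m k)) : Z j ∈ sphHarmonics m k :=
  hZ.span_eq ▸ Submodule.subset_span ⟨j, rfl⟩

theorem IsHarmonicONB.continuous {k : ℕ} {Z : Fin (dimHarmonics m k) → Sph m → ℂ}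
    (hZ : IsHarmonicONB m k Z) (j : Fin (dimHarmonics m k)) : Continuous (Z j) :=
  continuous_of_mem_sphHarmonics (hZ.mem j)

theorem integrable_mul_conj_of_continuous {f g : Sph m → ℂ} (hf : Integrable f (sphMeasure m))
    (hg : Continuous g) : Integrable (fun x => f x * starRingEnd ℂ (g x)) (sphMeasure m) := by
  obtain ⟨B, hB⟩ := hg.bounded_above_of_compact_support (HasCompactSupport.of_compactSpace g)
  refine hf.mul_bdd (c := B) (Complex.continuous_conj.comp hg).aestronglyMeasurable
    (.of_forall fun x => ?_)
  simpa using hB x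

theorem integral_mul_conj_sum {k : ℕ} {Z : Fin (dimHarmonics m k) → Sph m → ℂ}
    (hZ : IsHarmonicONB m k Z) {f : Sph m → ℂ} (hf : Integrable f (sphMeasure m))
    (c : Fin (dimHarmonics m k) → ℂ) :
    ∫ x, f x * starRingEnd ℂ (∑ j, c j * Z j x) ∂(sphMeasure m) =
      ∑ j, starRingEnd ℂ (c j) * ∫ x, f x * starRingEnd ℂ (Z j x) ∂(sphMeasure m) := by
  have h : ∀ x, f x * starRingEnd ℂ (∑ j, c j * Z j x) =
      ∑ j, starRingEnd ℂ (c j) * (f x * starRingEnd ℂ (Z j x)) := fun x => by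
    simp only [map_sum, map_mul, Finset.mul_sum]
    exact Finset.sum_congr rfl fun j _ => by ring
  simp only [h]
  rw [integral_finsetSum _ fun j _ =>
    (integrable_mul_conj_of_continuous hf (hZ.continuous j)).const_mul _]
  simp only [integral_const_mul]

theorem integral_sum_mul_conj {k : ℕ} {Z : Fin (dimHarmonics m k) → Sph m → ℂ}
    (hZ : IsHarmonicONB m k Z) (c : Fin (dimHarmonics m k) → ℂ) (i : Fin (dimHarmonics m k)) :
    ∫ x, (∑ j, c j * Z j x) * starRingEnd ℂ (Z i x) ∂(sphMeasure m) = c i := by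
  simp only [Finset.sum_mul, mul_assoc]
  rw [integral_finsetSum _ fun j _ => (integrable_mul_conj_of_continuous
    (hZ.continuous j).integrable_sph (hZ.continuous i)).const_mul _]
  simp only [integral_const_mul, hZ.orthonormal]
  simp

theorem integral_normSq_sum {k : ℕ} {Z : Fin (dimHarmonics m k) → Sph m → ℂ}
    (hZ : IsHarmonicONB m k Z) (c : Fin (dimHarmonics m k) → ℂ) :
    ∫ x, (∑ j, c j * Z j x) * starRingEnd ℂ (∑ j, c j * Z j x) ∂(sphMeasure m) =
      ((∑ j, ‖c j‖ ^ 2 : ℝ) : ℂ) := by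
  have hc : Continuous fun x => ∑ j, c j * Z j x :=
    continuous_finsetSum _ fun j _ => continuous_const.mul (hZ.continuous j)
  rw [integral_mul_conj_sum hZ hc.integrable_sph]
  simp only [integral_sum_mul_conj hZ]
  push_cast
  exact Finset.sum_congr rfl fun j _ => Complex.conj_mul' _

theorem norm_sum_mul_le {ι : Type*} [Fintype ι] (a b : ι → ℂ) :
    ‖∑ j, a j * b j‖ ≤ √(∑ j, ‖a j‖ ^ 2) * √(∑ j, ‖b j‖ ^ 2) := by
  refine (norm_sum_le _ _).trans ?_
  simp only [norm_mul]
  exact Real.sum_mul_le_sqrt_mul_sqrt _ _ _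

/-- Let `g` be the reproducing kernel at `x` and `L` an isometry taking `y` to `x`. Then `g ∘ L`
lies in `H_k` with the same `L²` norm as `g`, and its value at `y` is `g x = ∑ⱼ |Zⱼ(x)|²`.
Cauchy–Schwarz at `y` gives the bound after cancelling a square root. -/
theorem sum_normSq_le {k : ℕ} {Z : Fin (dimHarmonics m k) → Sph m → ℂ}
    (hZ : IsHarmonicONB m k Z) (x y : Sph m) : ∑ j, ‖Z j x‖ ^ 2 ≤ ∑ j, ‖Z j y‖ ^ 2 := by
  obtain ⟨L, hL⟩ := exists_sphMap_eq y x
  set g : Sph m → ℂ := fun z => ∑ j, starRingEnd ℂ (Z j x) * Z j z with hg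
  have hgm : g ∈ sphHarmonics m k := by
    have : g = ∑ j, starRingEnd ℂ (Z j x) • Z j := by ext z; simp [hg]
    rw [this]
    exact Submodule.sum_mem _ fun j _ => Submodule.smul_mem _ _ (hZ.mem j)
  have hgx : g x = ((∑ j, ‖Z j x‖ ^ 2 : ℝ) : ℂ) := by
    simp only [hg]
    push_cast
    exact Finset.sum_congr rfl fun j _ => Complex.conj_mul' _
  have hL' := comp_sphMap_mem_sphHarmonics L hgm
  rw [← hZ.span_eq, Submodule.mem_span_range_iff_exists_fun] at hL'
  obtain ⟨c, hc⟩ := hL'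
  have hc' : ∀ z, g (sphMap L z) = ∑ j, c j * Z j z := fun z => by
    have := congrFun hc z
    simpa using this.symm
  have h1 : ∑ j, ‖c j‖ ^ 2 = ∑ j, ‖Z j x‖ ^ 2 := by
    have e1 := integral_normSq_sum hZ c
    simp only [← hc'] at e1
    rw [integral_comp_sphMap L fun z => g z * starRingEnd ℂ (g z), hg, integral_normSq_sum hZ] at e1
    have := Complex.ofReal_injective e1
    simpa using this.symm
  have h2 := norm_sum_mul_le c fun j => Z j y
  rw [← hc', hL, hgx, h1, Complex.norm_real, Real.norm_of_nonneg (by positivity)] at h2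
  have h3 : 0 ≤ ∑ j, ‖Z j x‖ ^ 2 := by positivity
  rcases h3.eq_or_lt with h | h
  · rw [← h]; positivity
  · have h4 := Real.mul_self_sqrt h3
    have h5 : 0 < √(∑ j, ‖Z j x‖ ^ 2) := Real.sqrt_pos.mpr h
    refine (Real.sqrt_le_sqrt_iff (by positivity)).mp ?_
    refine le_of_mul_le_mul_left ?_ h5
    rw [h4]
    exact h2

/-- The addition theorem on the diagonal: `∑ⱼ |Yⱼ(x)|² = d_k / ω_m`. -/
theorem sum_normSq_eq {k : ℕ} {Z : Fin (dimHarmonics m k) → Sph m → ℂ}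
    (hZ : IsHarmonicONB m k Z) (x : Sph m) :
    ∑ j, ‖Z j x‖ ^ 2 = dimHarmonics m k / omegaSph m := by
  have h1 : ∫ y, ∑ j, ‖Z j y‖ ^ 2 ∂(sphMeasure m) = dimHarmonics m k := by
    rw [integral_finsetSum _ fun j _ => (show Continuous fun y => ‖Z j y‖ ^ 2 from
      (hZ.continuous j).norm.pow 2).integrable_sph]
    have : ∀ j, ∫ y, ‖Z j y‖ ^ 2 ∂(sphMeasure m) = 1 := fun j => by
      have := hZ.orthonormal j j
      simp only [Complex.mul_conj', if_true] at this
      rw [← Complex.ofReal_injective.eq_iff, ← integral_complex_ofReal]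
      simpa using this
    simp [this]
  have h2 : ∀ y, ∑ j, ‖Z j y‖ ^ 2 = ∑ j, ‖Z j x‖ ^ 2 := fun y =>
    le_antisymm (sum_normSq_le hZ y x) (sum_normSq_le hZ x y)
  simp only [h2, integral_const, sphMeasure_real_univ, smul_eq_mul] at h1
  rw [← h1, mul_div_cancel_left₀ _ omegaSph_pos.ne']

/-- Pairing `f` with its own projection gives `A`. The projection is at most `√A √(d_k/ω_m)`
pointwise, by Cauchy–Schwarz and the addition theorem. -/
theorem sqrt_sum_normSq_fourier_le (hY : ∀ k, IsHarmonicONB m k (Y k)) {f : Sph m → ℂ}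
    (hf : Integrable f (sphMeasure m)) (k : ℕ) :
    √(∑ j, ‖sphFourier Y f k j‖ ^ 2) ≤
      √(dimHarmonics m k / omegaSph m) * ∫ x, ‖f x‖ ∂(sphMeasure m) := by
  set A := ∑ j, ‖sphFourier Y f k j‖ ^ 2 with hA
  have hA0 : 0 ≤ A := by positivity
  have h1 := integral_mul_conj_sum (hY k) hf (sphFourier Y f k)
  have h2 : ∑ j, starRingEnd ℂ (sphFourier Y f k j) *
      ∫ x, f x * starRingEnd ℂ (Y k j x) ∂(sphMeasure m) = (A : ℂ) := by
    rw [hA]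
    push_cast
    exact Finset.sum_congr rfl fun j _ => Complex.conj_mul' _
  rw [h2] at h1
  have h3 : A ≤ ∫ x, ‖f x‖ * (√A * √(dimHarmonics m k / omegaSph m)) ∂(sphMeasure m) := by
    calc A = ‖(A : ℂ)‖ := by rw [Complex.norm_real, Real.norm_of_nonneg hA0]
      _ ≤ _ := by
        rw [← h1]
        refine norm_integral_le_of_norm_le (hf.norm.mul_const _) (.of_forall fun x => ?_)
        rw [norm_mul, RCLike.norm_conj, ← sum_normSq_eq (hY k) x]
        exact mul_le_mul_of_nonneg_left (norm_sum_mul_le _ _) (norm_nonneg _)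
  rw [integral_mul_const] at h3
  rcases hA0.eq_or_lt with h | h
  · rw [← h, Real.sqrt_zero]
    exact mul_nonneg (Real.sqrt_nonneg _) (integral_nonneg fun x => norm_nonneg _)
  · refine le_of_mul_le_mul_left ?_ (Real.sqrt_pos.mpr h)
    rw [Real.mul_self_sqrt hA0]
    linarith

end Christoffel

/-! ### Completeness of spherical harmonics and Parseval's identity -/

section Completeness

open MvPolynomial

/-- Polynomials as continuous functions on the sphere. -/
def polyToContinuousMap (m : ℕ) : MvPolynomial (Fin (m + 1)) ℂ →ₐ[ℂ] C(Sph m, ℂ) :=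
  aeval fun i => ⟨fun x => ((x.1 i : ℝ) : ℂ), by fun_prop⟩

theorem polyToContinuousMap_apply (P : MvPolynomial (Fin (m + 1)) ℂ) (x : Sph m) :
    polyToContinuousMap m P x = restrictSph m P x := by
  rw [restrictSph_apply]
  have := comp_aeval_apply (fun i => (⟨fun x => ((x.1 i : ℝ) : ℂ), by fun_prop⟩ : C(Sph m, ℂ)))
    (ContinuousMap.evalAlgHom ℂ ℂ x) P
  exact this

/-- The star subalgebra of polynomial functions on the sphere. -/
def polyStarSubalgebra (m : ℕ) : StarSubalgebra ℂ C(Sph m, ℂ) :=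
  { (polyToContinuousMap m).range with
    star_mem' := by
      rintro _ ⟨P, rfl⟩
      refine ⟨polyConj P, ?_⟩
      ext x
      change polyToContinuousMap m _ x = starRingEnd ℂ (polyToContinuousMap m P x)
      rw [polyToContinuousMap_apply, polyToContinuousMap_apply, restrictSph_polyConj] }

theorem denseRange_polyToContinuousMap : DenseRange (polyToContinuousMap m) := by
  have h := ContinuousMap.starSubalgebra_topologicalClosure_eq_top_of_separatesPoints
    (polyStarSubalgebra m) (by
      intro x y hxy
      obtain ⟨i, hi⟩ : ∃ i, x.1 i ≠ y.1 i := by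
        by_contra! hcon
        exact hxy (Subtype.ext (PiLp.ext hcon))
      refine ⟨_, ⟨polyToContinuousMap m (X i), ⟨X i, rfl⟩, rfl⟩, ?_⟩
      simpa [polyToContinuousMap_apply, restrictSph_apply] using hi)
  have h2 : closure (polyStarSubalgebra m : Set C(Sph m, ℂ)) = Set.univ := by
    have := congrArg (fun S : StarSubalgebra ℂ C(Sph m, ℂ) => (S : Set C(Sph m, ℂ))) h
    simpa using this
  exact dense_iff_closure_eq.mpr h2

variable {Y : (k : ℕ) → Fin (dimHarmonics m k) → Sph m → ℂ}

theorem memLp_sph_of_continuous {f : Sph m → ℂ} (hf : Continuous f) (p : ℝ≥0∞) :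
    MemLp f p (sphMeasure m) := by
  obtain ⟨B, hB⟩ := hf.bounded_above_of_compact_support (HasCompactSupport.of_compactSpace _)
  exact MemLp.of_bound hf.aestronglyMeasurable B (.of_forall hB)

theorem IsHarmonicONB.memLp (hY : ∀ k, IsHarmonicONB m k (Y k)) (p : ℝ≥0∞) (k : ℕ)
    (j : Fin (dimHarmonics m k)) : MemLp (Y k j) p (sphMeasure m) :=
  memLp_sph_of_continuous ((hY k).continuous j) p

/-- The orthonormal system of spherical harmonics in `L²`. -/
def harmonicLp (hY : ∀ k, IsHarmonicONB m k (Y k)) (i : Σ k, Fin (dimHarmonics m k)) :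
    Lp ℂ 2 (sphMeasure m) :=
  (IsHarmonicONB.memLp hY 2 i.1 i.2).toLp

theorem inner_harmonicLp (hY : ∀ k, IsHarmonicONB m k (Y k)) (i : Σ k, Fin (dimHarmonics m k))
    (f : Lp ℂ 2 (sphMeasure m)) : inner ℂ (harmonicLp hY i) f = sphFourier Y f i.1 i.2 := by
  rw [L2.inner_def, sphFourier]
  refine integral_congr_ae ?_
  filter_upwards [(IsHarmonicONB.memLp hY 2 i.1 i.2).coeFn_toLp] with x hx
  rw [harmonicLp, hx]
  simp

theorem orthonormal_harmonicLp (hm : 1 ≤ m) (hY : ∀ k, IsHarmonicONB m k (Y k)) :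
    Orthonormal ℂ (harmonicLp hY) := by
  classical
  rw [orthonormal_iff_ite]
  rintro ⟨k, i⟩ ⟨l, j⟩
  rw [inner_harmonicLp, sphFourier]
  have h1 : ∫ x, harmonicLp hY ⟨l, j⟩ x * starRingEnd ℂ (Y k i x) ∂(sphMeasure m) =
      ∫ x, Y l j x * starRingEnd ℂ (Y k i x) ∂(sphMeasure m) := by
    refine integral_congr_ae ?_
    filter_upwards [(IsHarmonicONB.memLp hY 2 l j).coeFn_toLp] with x hx
    rw [harmonicLp, hx]
  rw [h1]
  rcases eq_or_ne k l with rfl | hkl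
  · rw [(hY k).orthonormal]
    simp [eq_comm]
  · rw [sphHarmonics_orthogonal hm hkl.symm ((hY l).mem j) ((hY k).mem i), if_neg]
    exact fun h => hkl (congrArg Sigma.fst h)

theorem exists_mem_span_harmonicLp (hY : ∀ k, IsHarmonicONB m k (Y k)) {f : Sph m → ℂ}
    (hf : f ∈ ⨆ k, sphHarmonics m k) :
    ∃ g ∈ Submodule.span ℂ (Set.range (harmonicLp hY)), g =ᵐ[sphMeasure m] f := by
  induction hf using Submodule.iSup_induction' with
  | mem k f hf =>
    rw [← (hY k).span_eq] at hf
    induction hf using Submodule.span_induction with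
    | mem f hf =>
      obtain ⟨j, rfl⟩ := hf
      exact ⟨harmonicLp hY ⟨k, j⟩, Submodule.subset_span ⟨_, rfl⟩, MemLp.coeFn_toLp _⟩
    | zero => exact ⟨0, Submodule.zero_mem _, Lp.coeFn_zero _ _ _⟩
    | add f g _ _ hf hg =>
      obtain ⟨f', hf', hff⟩ := hf
      obtain ⟨g', hg', hgg⟩ := hg
      exact ⟨f' + g', Submodule.add_mem _ hf' hg', (Lp.coeFn_add _ _).trans (hff.add hgg)⟩
    | smul c f _ hf =>
      obtain ⟨f', hf', hff⟩ := hf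
      exact ⟨c • f', Submodule.smul_mem _ _ hf', (Lp.coeFn_smul _ _).trans (hff.const_smul c)⟩
  | zero => exact ⟨0, Submodule.zero_mem _, Lp.coeFn_zero _ _ _⟩
  | add f g _ _ hf hg =>
    obtain ⟨f', hf', hff⟩ := hf
    obtain ⟨g', hg', hgg⟩ := hg
    exact ⟨f' + g', Submodule.add_mem _ hf' hg', (Lp.coeFn_add _ _).trans (hff.add hgg)⟩

/-- Polynomials are uniformly dense in `C(S^m)`, which is dense in `L²`, and each polynomial
restricts to a finite sum of harmonics. -/
theorem span_harmonicLp_dense (hY : ∀ k, IsHarmonicONB m k (Y k)) :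
    ⊤ ≤ (Submodule.span ℂ (Set.range (harmonicLp hY))).topologicalClosure := by
  have hd : DenseRange ((ContinuousMap.toLp 2 (sphMeasure m) ℂ : C(Sph m, ℂ) →L[ℂ] _) ∘
      polyToContinuousMap m) :=
    (ContinuousMap.toLp_denseRange ℂ (sphMeasure m) ℂ (by norm_num)).comp
      denseRange_polyToContinuousMap (ContinuousLinearMap.continuous _)
  intro f _
  refine closure_mono ?_ (hd f)
  rintro _ ⟨P, rfl⟩
  obtain ⟨g, hg, hgP⟩ := exists_mem_span_harmonicLp hY (restrictSph_mem_iSup_sphHarmonics P)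
  have : (ContinuousMap.toLp 2 (sphMeasure m) ℂ : C(Sph m, ℂ) →L[ℂ] _) (polyToContinuousMap m P)
      = g := by
    refine Lp.ext ((ContinuousMap.coeFn_toLp _ _).trans (Filter.EventuallyEq.trans ?_ hgP.symm))
    exact .of_forall fun x => polyToContinuousMap_apply P x
  rw [Function.comp_apply, this]
  exact hg

/-- Parseval's identity for spherical harmonic expansions. -/
theorem hasSum_normSq_fourier (hm : 1 ≤ m) (hY : ∀ k, IsHarmonicONB m k (Y k))
    (f : Lp ℂ 2 (sphMeasure m)) :
    HasSum (fun k => ∑ j, ‖sphFourier Y f k j‖ ^ 2) (‖f‖ ^ 2) := by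
  let b := HilbertBasis.mk (orthonormal_harmonicLp hm hY) (span_harmonicLp_dense hY)
  have h := b.hasSum_inner_mul_inner f f
  have h1 : ∀ i, inner ℂ f (b i) * inner ℂ (b i) f = ((‖sphFourier Y f i.1 i.2‖ ^ 2 : ℝ) : ℂ) :=
    fun i => by
      rw [← inner_harmonicLp hY, ← inner_conj_symm, HilbertBasis.coe_mk]
      push_cast
      exact Complex.conj_mul' _
  simp only [h1] at h
  rw [inner_self_eq_norm_sq_to_K] at h
  have h2 : HasSum (fun i : Σ k, Fin (dimHarmonics m k) => ‖sphFourier Y f i.1 i.2‖ ^ 2)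
      (‖f‖ ^ 2) := by
    rw [← Complex.hasSum_ofReal]
    simpa using h
  exact h2.sigma fun k => hasSum_fintype _

end Completeness

end

noncomputable section

/-! ### Hausdorff–Young for the sphere, and multiplier operators -/

variable {m : ℕ} {Y : (k : ℕ) → Fin (dimHarmonics m k) → Sph m → ℂ}

theorem sphFourier_congr_ae {f g : Sph m → ℂ} (h : f =ᵐ[sphMeasure m] g) (k : ℕ)
    (j : Fin (dimHarmonics m k)) : sphFourier Y f k j = sphFourier Y g k j := by
  refine integral_congr_ae ?_
  filter_upwards [h] with x hx
  rw [hx]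

theorem sphFourier_add (hY : ∀ k, IsHarmonicONB m k (Y k)) {f g : Sph m → ℂ}
    (hf : Integrable f (sphMeasure m)) (hg : Integrable g (sphMeasure m)) (k : ℕ)
    (j : Fin (dimHarmonics m k)) :
    sphFourier Y (fun x => f x + g x) k j = sphFourier Y f k j + sphFourier Y g k j := by
  simp only [sphFourier, add_mul]
  exact integral_add (integrable_mul_conj_of_continuous hf ((hY k).continuous j))
    (integrable_mul_conj_of_continuous hg ((hY k).continuous j))

theorem sphFourier_const_mul (c : ℂ) (f : Sph m → ℂ) (k : ℕ) (j : Fin (dimHarmonics m k)) :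
    sphFourier Y (fun x => c * f x) k j = c * sphFourier Y f k j := by
  simp only [sphFourier, mul_assoc, integral_const_mul]

theorem integrable_coe_Lp {P : ℝ≥0∞} (hP : 1 ≤ P) (f : Lp ℂ P (sphMeasure m)) :
    Integrable f (sphMeasure m) :=
  (Lp.memLp f).integrable hP

theorem norm_toLp_eq_integral_rpow {P : ℝ≥0∞} (hP0 : P ≠ 0) (hP : P ≠ ∞) {f : Sph m → ℂ}
    (hf : MemLp f P (sphMeasure m)) :
    ‖hf.toLp‖ = (∫ x, ‖f x‖ ^ P.toReal ∂(sphMeasure m)) ^ (1 / P.toReal) := by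
  rw [Lp.norm_toLp, hf.eLpNorm_eq_integral_rpow_norm hP0 hP, ENNReal.toReal_ofReal, one_div]
  exact Real.rpow_nonneg (integral_nonneg fun x => Real.rpow_nonneg (norm_nonneg _) _) _

theorem hasSum_normSq_fourier_of_eq_two (hm : 1 ≤ m) (hY : ∀ k, IsHarmonicONB m k (Y k))
    {P : ℝ≥0∞} (hP : P = 2) (f : Lp ℂ P (sphMeasure m)) :
    HasSum (fun k => ∑ j, ‖sphFourier Y f k j‖ ^ 2) (‖f‖ ^ 2) := by
  subst hP
  exact hasSum_normSq_fourier hm hY f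

theorem sum_normSq_fourier_le_integral (hm : 1 ≤ m) (hY : ∀ k, IsHarmonicONB m k (Y k))
    {f : Sph m → ℂ} (hf : MemLp f 2 (sphMeasure m)) (s : Finset ℕ) :
    ∑ k ∈ s, ∑ j, ‖sphFourier Y f k j‖ ^ 2 ≤ ∫ x, ‖f x‖ ^ 2 ∂(sphMeasure m) := by
  have h := sum_le_hasSum s (fun k _ => by positivity) (hasSum_normSq_fourier hm hY hf.toLp)
  have h2 := norm_toLp_eq_integral_rpow (by norm_num) (by norm_num) hf
  simp only [ENNReal.toReal_ofNat, Real.rpow_ofNat, ← Real.sqrt_eq_rpow] at h2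
  rw [h2, Real.sq_sqrt (integral_nonneg fun x => by positivity)] at h
  simpa only [sphFourier_congr_ae hf.coeFn_toLp] using h

section Factor

variable {V : Type*} [Fintype V] [MeasurableSpace V] [MeasurableSingletonClass V] {F : Sph m → V}

theorem memLp_comp_finite (hF : Measurable F) (h : V → ℂ) (P : ℝ≥0∞) :
    MemLp (fun x => h (F x)) P (sphMeasure m) := by
  refine MemLp.of_bound ((measurable_of_finite h).comp hF).aestronglyMeasurable (∑ v, ‖h v‖)
    (.of_forall fun x => ?_)
  exact Finset.single_le_sum (f := fun v => ‖h v‖) (fun v _ => norm_nonneg _) (Finset.mem_univ (F x))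

theorem integral_comp_finite (hF : Measurable F) (φ : V → ℝ) :
    ∫ x, φ (F x) ∂(sphMeasure m) = ∑ v, ((sphMeasure m).map F).real {v} * φ v := by
  rw [← integral_map hF.aemeasurable (measurable_of_finite φ).aestronglyMeasurable,
    integral_fintype .of_finite]
  simp

/-- The Fourier coefficients of degree `k` of functions that factor through `F`. -/
def fourierFactor (hY : ∀ k, IsHarmonicONB m k (Y k)) (hF : Measurable F) (k : ℕ) :
    (V → ℂ) →ₗ[ℂ] EuclideanSpace ℂ (Fin (dimHarmonics m k)) where
  toFun h := WithLp.toLp 2 fun j => sphFourier Y (fun x => h (F x)) k j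
  map_add' h h' := by
    ext j
    exact sphFourier_add hY ((memLp_comp_finite hF h 1).integrable le_rfl)
      ((memLp_comp_finite hF h' 1).integrable le_rfl) k j
  map_smul' c h := by
    ext j
    exact sphFourier_const_mul c _ k j

theorem norm_fourierFactor (hY : ∀ k, IsHarmonicONB m k (Y k)) (hF : Measurable F) (k : ℕ)
    (h : V → ℂ) : ‖fourierFactor hY hF k h‖ =
      √(∑ j, ‖sphFourier Y (fun x => h (F x)) k j‖ ^ 2) := by
  rw [EuclideanSpace.norm_eq]
  rfl

/-- The Hausdorff–Young inequality for functions with finitely many values. -/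
theorem hausdorffYoung_comp_finite (hm : 1 ≤ m) (hY : ∀ k, IsHarmonicONB m k (Y k))
    (hF : Measurable F) {p q : ℝ} (hp : 1 < p) (hp2 : p ≤ 2) (hpq : p.HolderConjugate q)
    (h : V → ℂ) (s : Finset ℕ) :
    (∑ k ∈ s, ((dimHarmonics m k : ℝ) ^ ((2 - q) / (2 * q)) *
      √(∑ j, ‖sphFourier Y (fun x => h (F x)) k j‖ ^ 2)) ^ q) ^ (1 / q) ≤
      omegaSph m ^ ((p - 2) / (2 * p)) *
        (∫ x, ‖h (F x)‖ ^ p ∂(sphMeasure m)) ^ (1 / p) := by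
  have hω := omegaSph_pos (m := m)
  -- The finite measure is the image of `σ_m` under `F`, and `C = ω_m^(-1/2)` comes from the
  -- addition theorem.
  have key := sum_rpow_le_of_interpolation (K := s) (V := V)
    (μ := fun v => ((sphMeasure m).map F).real {v}) (fun v => measureReal_nonneg)
    (d := fun k => (dimHarmonics m k : ℝ)) (fun k => Nat.cast_nonneg _)
    (C := (√(omegaSph m))⁻¹) (by positivity) (fun k => fourierFactor hY hF k)
    (fun h k => ?_) (fun h => ?_) hp hp2 hpq h
  · rw [Finset.sum_coe_sort s fun k => ((dimHarmonics m k : ℝ) ^ ((2 - q) / (2 * q)) *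
      ‖fourierFactor hY hF k h‖) ^ q, ← integral_comp_finite hF fun v => ‖h v‖ ^ p] at key
    simp only [norm_fourierFactor] at key
    have hC : (√(omegaSph m))⁻¹ ^ ((2 - p) / p) = omegaSph m ^ ((p - 2) / (2 * p)) := by
      rw [Real.sqrt_eq_rpow, ← Real.rpow_neg hω.le, ← Real.rpow_mul hω.le]
      congr 1
      field_simp
      ring
    rwa [hC] at key
  · rw [norm_fourierFactor, ← integral_comp_finite hF fun v => ‖h v‖]
    refine (sqrt_sum_normSq_fourier_le hY
      ((memLp_comp_finite hF h 1).integrable le_rfl) k).trans (le_of_eq ?_)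
    rw [Real.sqrt_div (Nat.cast_nonneg _)]
    ring
  · rw [← integral_comp_finite hF fun v => ‖h v‖ ^ 2,
      Finset.sum_coe_sort s fun k => ‖fourierFactor hY hF k h‖ ^ 2]
    refine le_trans (le_of_eq (Finset.sum_congr rfl fun k _ => ?_))
      (sum_normSq_fourier_le_integral hm hY (memLp_comp_finite hF h 2) s)
    rw [norm_fourierFactor, Real.sq_sqrt (by positivity)]

end Factor

theorem continuous_sphFourier (hY : ∀ k, IsHarmonicONB m k (Y k)) {P Q : ℝ≥0∞}
    [Fact (1 ≤ P)] [Fact (1 ≤ Q)] [P.HolderConjugate Q] (k : ℕ) (j : Fin (dimHarmonics m k)) :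
    Continuous fun f : Lp ℂ P (sphMeasure m) => sphFourier Y f k j := by
  have hc : MemLp (fun x => starRingEnd ℂ (Y k j x)) Q (sphMeasure m) :=
    memLp_sph_of_continuous (Complex.continuous_conj.comp ((hY k).continuous j)) Q
  have h : ∀ f : Lp ℂ P (sphMeasure m), sphFourier Y f k j =
      (ContinuousLinearMap.mul ℂ ℂ).lpPairing (sphMeasure m) P Q f hc.toLp := fun f => by
    rw [ContinuousLinearMap.lpPairing_eq_integral, sphFourier]
    refine integral_congr_ae ?_
    filter_upwards [hc.coeFn_toLp] with x hx
    rw [hx]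
    rfl
  simp only [h]
  fun_prop

/-- The Hausdorff–Young inequality for partial sums of spherical harmonic expansions. -/
theorem hausdorffYoung_finset (hm : 1 ≤ m) (hY : ∀ k, IsHarmonicONB m k (Y k))
    {p q : ℝ} (hp : 1 < p) (hp2 : p ≤ 2) (hpq : p.HolderConjugate q) (s : Finset ℕ)
    (f : Lp ℂ (ENNReal.ofReal p) (sphMeasure m)) :
    (∑ k ∈ s, ((dimHarmonics m k : ℝ) ^ ((2 - q) / (2 * q)) *
      √(∑ j, ‖sphFourier Y f k j‖ ^ 2)) ^ q) ^ (1 / q) ≤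
      omegaSph m ^ ((p - 2) / (2 * p)) * ‖f‖ := by
  have hq0 : 0 < q := hpq.symm.pos
  have hq1 : 1 ≤ q := hpq.symm.lt.le
  have : Fact (1 ≤ ENNReal.ofReal p) := ⟨by simpa using hp.le⟩
  have : Fact (1 ≤ ENNReal.ofReal q) := ⟨by simpa using hq1⟩
  have := hpq.ennrealOfReal
  have hP0 : ENNReal.ofReal p ≠ 0 := by simpa using (by linarith : 0 < p)
  have hPt : (ENNReal.ofReal p).toReal = p := ENNReal.toReal_ofReal (by linarith)
  refine (Lp.simpleFunc.denseRange ENNReal.ofReal_ne_top).induction_on (p := fun f =>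
    (∑ k ∈ s, ((dimHarmonics m k : ℝ) ^ ((2 - q) / (2 * q)) *
      √(∑ j, ‖sphFourier Y f k j‖ ^ 2)) ^ q) ^ (1 / q) ≤
      omegaSph m ^ ((p - 2) / (2 * p)) * ‖f‖) f ?_ fun g => ?_
  -- Since `s` is finite, both sides are continuous in `f`; it remains to treat simple functions.
  · refine isClosed_le ?_ (continuous_const.mul continuous_norm)
    refine Continuous.rpow_const (continuous_finsetSum _ fun k _ => ?_)
      fun _ => Or.inr (by positivity)
    refine Continuous.rpow_const (continuous_const.mul (Continuous.sqrt ?_)) fun _ => Or.inr hq0.le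
    exact continuous_finsetSum _ fun j _ =>
      (continuous_sphFourier (Q := ENNReal.ofReal q) hY k j).norm.pow 2
  · set u := Lp.simpleFunc.toSimpleFunc g
    have hu : u =ᵐ[sphMeasure m] (g : Lp ℂ (ENNReal.ofReal p) (sphMeasure m)) :=
      Lp.simpleFunc.toSimpleFunc_eq_toFun g
    -- A simple function is the inclusion of its finite range composed with itself.
    have hF : Measurable fun x => (⟨u x, u.mem_range_self x⟩ : u.range) :=
      u.measurable.subtype_mk
    have key := hausdorffYoung_comp_finite hm hY hF hp hp2 hpq (fun v => (v : ℂ)) s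
    have hn : ‖(g : Lp ℂ (ENNReal.ofReal p) (sphMeasure m))‖ =
        (∫ x, ‖u x‖ ^ p ∂(sphMeasure m)) ^ (1 / p) := by
      have h1 := norm_toLp_eq_integral_rpow hP0 ENNReal.ofReal_ne_top
        (Lp.memLp (g : Lp ℂ (ENNReal.ofReal p) (sphMeasure m)))
      rw [Lp.toLp_coeFn, hPt] at h1
      rw [h1]
      congr 1
      refine integral_congr_ae ?_
      filter_upwards [hu] with x hx
      rw [hx]
    rw [hn]
    simpa only [sphFourier_congr_ae hu] using key

/-- A multiplier operator multiplies the Fourier coefficients. -/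
theorem IsMultiplierOperator.sphFourier_sub (hY : ∀ k, IsHarmonicONB m k (Y k)) {P : ℝ≥0∞}
    (hP : 1 ≤ P) {M : Lp ℂ P (sphMeasure m) →ₗ[ℂ] Lp ℂ P (sphMeasure m)} {η : ℕ → ℂ}
    (hM : IsMultiplierOperator Y M η) (f : Lp ℂ P (sphMeasure m)) (k : ℕ)
    (j : Fin (dimHarmonics m k)) :
    sphFourier Y (M f - f : Lp ℂ P (sphMeasure m)) k j = (η k - 1) * sphFourier Y f k j := by
  have h1 : sphFourier Y (M f) k j = η k * sphFourier Y f k j := by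
    -- The hypothesis concerns projections; orthonormality reads the coefficients back from them.
    rw [← integral_sum_mul_conj (hY k) (sphFourier Y (M f) k) j,
      ← integral_sum_mul_conj (hY k) (sphFourier Y f k) j, ← integral_const_mul]
    refine integral_congr_ae (.of_forall fun x => ?_)
    have := congrFun (hM f k) x
    simp only [sphProj, Pi.smul_apply, smul_eq_mul] at this
    simp only [this, mul_assoc]
  have h2 : ((M f - f : Lp ℂ P (sphMeasure m)) : Sph m → ℂ) =ᵐ[sphMeasure m]
      fun x => M f x + (-1) * f x := by
    filter_upwards [Lp.coeFn_sub (M f) f] with x hx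
    rw [hx, Pi.sub_apply]
    ring
  rw [sphFourier_congr_ae h2, sphFourier_add hY (integrable_coe_Lp hP _)
    ((integrable_coe_Lp hP f).const_mul _), sphFourier_const_mul, h1]
  ring

theorem IsMultiplierOperator.sqrt_sum_normSq (hY : ∀ k, IsHarmonicONB m k (Y k)) {P : ℝ≥0∞}
    (hP : 1 ≤ P) {M : Lp ℂ P (sphMeasure m) →ₗ[ℂ] Lp ℂ P (sphMeasure m)} {η : ℕ → ℂ}
    (hM : IsMultiplierOperator Y M η) (f : Lp ℂ P (sphMeasure m)) (k : ℕ) (a : ℝ) :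
    a * ‖η k - 1‖ * (∑ j, ‖sphFourier Y f k j‖ ^ 2) ^ ((1 : ℝ) / 2) =
      a * √(∑ j, ‖sphFourier Y (M f - f : Lp ℂ P (sphMeasure m)) k j‖ ^ 2) := by
  simp only [hM.sphFourier_sub hY hP, norm_mul, mul_pow, ← Finset.mul_sum]
  rw [Real.sqrt_mul (by positivity), Real.sqrt_sq (norm_nonneg _), Real.sqrt_eq_rpow, mul_assoc]

end

/-! ### The main theorem -/

theorem mainTheorem3 (m : ℕ) (hm : 2 ≤ m)
    (Y : (k : ℕ) → Fin (dimHarmonics m k) → Sph m → ℂ)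
    (hY : ∀ k, IsHarmonicONB m k (Y k)) (η : ℕ → ℂ) :
    (∀ p q : ℝ, 1 < p → p ≤ 2 → p.HolderConjugate q →
      ∀ M : Lp ℂ (ENNReal.ofReal p) (sphMeasure m) →ₗ[ℂ] Lp ℂ (ENNReal.ofReal p) (sphMeasure m),
      IsMultiplierOperator Y M η → ∀ f : Lp ℂ (ENNReal.ofReal p) (sphMeasure m),
        Summable (fun k : ℕ =>
          ((dimHarmonics m k : ℝ) ^ ((2 - q) / (2 * q)) * ‖η k - 1‖ *
            (∑ j, ‖sphFourier Y f k j‖ ^ 2) ^ ((1 : ℝ) / 2)) ^ q) ∧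
        (∑' k : ℕ,
          ((dimHarmonics m k : ℝ) ^ ((2 - q) / (2 * q)) * ‖η k - 1‖ *
            (∑ j, ‖sphFourier Y f k j‖ ^ 2) ^ ((1 : ℝ) / 2)) ^ q) ^ (1 / q)
          ≤ omegaSph m ^ ((p - 2) / (2 * p)) * ‖M f - f‖ ∧
        (p = 2 →
          (∑' k : ℕ,
            ((dimHarmonics m k : ℝ) ^ ((2 - q) / (2 * q)) * ‖η k - 1‖ *
              (∑ j, ‖sphFourier Y f k j‖ ^ 2) ^ ((1 : ℝ) / 2)) ^ q) ^ (1 / q)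
            = omegaSph m ^ ((p - 2) / (2 * p)) * ‖M f - f‖)) ∧
    (∀ M : Lp ℂ 1 (sphMeasure m) →ₗ[ℂ] Lp ℂ 1 (sphMeasure m),
      IsMultiplierOperator Y M η → ∀ f : Lp ℂ 1 (sphMeasure m),
        BddAbove (Set.range fun k : ℕ =>
          (dimHarmonics m k : ℝ) ^ (-(1 : ℝ) / 2) * ‖η k - 1‖ *
            (∑ j, ‖sphFourier Y f k j‖ ^ 2) ^ ((1 : ℝ) / 2)) ∧
        (⨆ k : ℕ, (dimHarmonics m k : ℝ) ^ (-(1 : ℝ) / 2) * ‖η k - 1‖ *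
            (∑ j, ‖sphFourier Y f k j‖ ^ 2) ^ ((1 : ℝ) / 2))
          ≤ omegaSph m ^ (-(1 : ℝ) / 2) * ‖M f - f‖) := by
  have hm1 : 1 ≤ m := by omega
  have hω := omegaSph_pos (m := m)
  refine ⟨fun p q hp hp2 hpq M hM f => ?_, fun M hM f => ?_⟩
  · have hP : 1 ≤ ENNReal.ofReal p := by simpa using hp.le
    have : Fact (1 ≤ ENNReal.ofReal p) := ⟨hP⟩
    have hq0 : 0 < q := hpq.symm.pos
    -- The multipliers are absorbed here: only coefficients of `M f - f` remain.
    simp only [hM.sqrt_sum_normSq hY hP f]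
    set g := M f - f
    set B := omegaSph m ^ ((p - 2) / (2 * p)) * ‖g‖ with hB
    have hB0 : 0 ≤ B := mul_nonneg (Real.rpow_nonneg hω.le _) (norm_nonneg _)
    set a : ℕ → ℝ := fun k => ((dimHarmonics m k : ℝ) ^ ((2 - q) / (2 * q)) *
      √(∑ j, ‖sphFourier Y g k j‖ ^ 2)) ^ q with ha
    have ha0 : ∀ k, 0 ≤ a k := fun k => by positivity
    have hs : ∀ s : Finset ℕ, ∑ k ∈ s, a k ≤ B ^ q := fun s => by
      have h := Real.rpow_le_rpow (Real.rpow_nonneg (Finset.sum_nonneg fun k _ => ha0 k) _)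
        (hausdorffYoung_finset hm1 hY hp hp2 hpq s g) hq0.le
      rwa [← Real.rpow_mul (Finset.sum_nonneg fun k _ => ha0 k), one_div_mul_cancel hq0.ne',
        Real.rpow_one] at h
    refine ⟨summable_of_sum_le ha0 hs, ?_, fun h2 => ?_⟩
    · have h := Real.rpow_le_rpow (tsum_nonneg ha0) (Real.tsum_le_of_sum_le ha0 hs)
        (by positivity : 0 ≤ 1 / q)
      rwa [← Real.rpow_mul hB0, mul_one_div_cancel hq0.ne', Real.rpow_one] at h
    · have hq : q = 2 := by
        have := hpq.inv_add_inv_eq_one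
        rw [h2] at this
        have h3 : q⁻¹ = 2⁻¹ := by linarith
        exact inv_injective h3
      -- For `p = q = 2` the dimension weight has exponent `0`, and the series is the one in
      -- Parseval's identity.
      have h3 : a = fun k => ∑ j, ‖sphFourier Y g k j‖ ^ 2 := by
        ext k
        rw [ha, hq]
        simp only [sub_self, zero_div, Real.rpow_zero, one_mul, Real.rpow_ofNat]
        exact Real.sq_sqrt (by positivity)
      rw [hB, h3, (hasSum_normSq_fourier_of_eq_two hm1 hY (by rw [h2]; simp) g).tsum_eq, hq,
        ← Real.sqrt_eq_rpow, Real.sqrt_sq (norm_nonneg _),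
        show (p - 2) / (2 * p) = 0 by rw [h2]; norm_num, Real.rpow_zero, one_mul]
  · simp only [hM.sqrt_sum_normSq hY le_rfl f]
    set g := M f - f
    have hk : ∀ k, (dimHarmonics m k : ℝ) ^ (-(1 : ℝ) / 2) *
        √(∑ j, ‖sphFourier Y g k j‖ ^ 2) ≤ omegaSph m ^ (-(1 : ℝ) / 2) * ‖g‖ := fun k => by
      have h := sqrt_sum_normSq_fourier_le hY (integrable_coe_Lp le_rfl g) k
      rw [← L1.norm_eq_integral_norm] at h
      have hd : (0 : ℝ) ≤ dimHarmonics m k := Nat.cast_nonneg _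
      refine (mul_le_mul_of_nonneg_left h (Real.rpow_nonneg hd _)).trans ?_
      rw [← mul_assoc]
      refine mul_le_mul_of_nonneg_right ?_ (norm_nonneg _)
      have hinv : ∀ r : ℝ, 0 ≤ r → r ^ (-(1 : ℝ) / 2) = (√r)⁻¹ := fun r hr => by
        rw [neg_div, Real.rpow_neg hr, Real.sqrt_eq_rpow]
      rw [hinv _ hd, hinv _ hω.le, Real.sqrt_div hd, div_eq_mul_inv, ← mul_assoc]
      -- Only `(√d)⁻¹ √d ≤ 1` is used, so `d = 0` needs no separate case.
      exact mul_le_of_le_one_left (by positivity) (inv_mul_le_one)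
    exact ⟨⟨_, by rintro _ ⟨k, rfl⟩; exact hk k⟩, ciSup_le hk⟩
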